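/- Let $(\Omega,\mathcal F,\mathbb P)$ be a non-atomic probability space. **Signed Choquet integral.** Let $h:[0,1]\to\mathbb R$ be a distortion function (non-constant, of bounded variation, $h(0)=0$) that is absolutely continuous, with distortion weight function $\gamma$, i.e. $\gamma(u)$ is the left derivative of $h$ at $1-u$ for almost every $u\in(0,1)$, and suppose $0<\|\gamma\|_2<\infty$, where $\|\gamma\|_2^2=\int_0^1\gamma(u)^2\,du$. For a random variable $Y$ let $$I_h(Y)=\int_{-\infty}^0\big[h(\mathbb P(Y\ge x))-h(1)\big]dx+\int_0^\infty h(\mathbb P(Y\ge x))\,dx,$$ which is called finite if both integrals converge absolutely. **Aggregation function.** Let $n=m+k\ge 1$ and let $g:\mathbb R^n\to\mathbb R$ be $K$-Lipschitz with respect to the Euclidean norm, with a decomposition $g(x)=\tilde g(x^{(1)})+\beta^{T}x^{(2)}$, where $x=(x^{(1)},x^{(2)})\in\mathbb R^m\times\mathbb R^{k}$, $\tilde g:\mathbb R^m\to\mathbb R$ and $\beta\in\mathbb R^{k}$. **Uncertainty set.** Let $p\ge 1$ and let $X$ be an $n$-dimensional random vector with $X\in L^p$, $g(X)\in L^p$ and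 $I_h(g(X))$ finite. Let $Q$ be a positive definite diagonal $n\times n$ matrix with smallest and largest eigenvalues $q_{\min}$ and $q_{\max}$, let $\phi(x)=x^TQx$, whose Bregman divergence $B_\phi(x,y)=\phi(x)-\phi(y)-\nabla\phi(y)\cdot(x-y)$ is the squared Mahalanobis distance $(x-y)^TQ(x-y)$, and for $\varepsilon>0$ let $\mathfrak B_\varepsilon(X)$ be the set of all random vectors $Z$ on $\Omega$ with $$\inf_{Z'\overset{d}{=}Z,\;X'\overset{d}{=}X}\mathbb E\big[B_\phi(Z',X')\big]\le\varepsilon,$$ the infimum being over all couplings of the laws of $Z$ and $X$. Write $F^{-1}$ for the left-continuous quantile function of $g(X)$. For $l\in L^2((0,1))$ let $l^{\uparrow}$ be its isotonic projection, the minimizer of $\int_0^1(j(u)-l(u))^2du$ over all left-continuous, non-decreasing $j\in L^2((0,1))$. Then the following hold. (i) Suppose $\gamma$ is non-decreasing on $(0,1)$. Then $I_h(g(Y))$ is finite for every $Y\in\mathfrak B_\varepsilon(X)$, the supremum below is finite, and $$I_h(g(X))+\sqrt{\tfrac{\|\beta\|_2^2\,\varepsilon}{q_{\max}}}\;\|\gamma\|_2\;\le\;\sup_{Y\in\mathfrak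 B_\varepsilon(X)}I_h(g(Y))\;\le\; I_h(g(X))+\sqrt{\tfrac{K^2\varepsilon}{q_{\min}}}\;\|\gamma\|_2 .$$ (ii) Suppose $\gamma\ge 0$ on $(0,1)$ and $g(X)\in L^2$. Then $I_h(g(Y))$ is finite for every $Y\in\mathfrak B_\varepsilon(X)$ and the supremum $\sup_{Y\in\mathfrak B_\varepsilon(X)}I_h(g(Y))$ is finite. If $\beta\ne0$, the equation in $\lambda$ $$\int_0^1\Big(F^{-1}(u)-\big(F^{-1}+\tfrac{1}{2q_{\max}\lambda}\gamma\big)^{\uparrow}(u)\Big)^2du=\tfrac{\|\beta\|_2^2\,\varepsilon}{q_{\max}}$$ has a unique positive solution $\underline\lambda$, and $$\int_0^1\gamma(u)\big(F^{-1}+\tfrac{1}{2q_{\max}\underline\lambda}\gamma\big)^{\uparrow}(u)\,du\;\le\;\sup_{Y\in\mathfrak B_\varepsilon(X)}I_h(g(Y)).$$ If $K>0$ (which is automatic when $g$ is non-constant), the equation in $\lambda$ $$\int_0^1\Big(F^{-1}(u)-\big(F^{-1}+\tfrac{1}{2q_{\min}\lambda}\gamma\big)^{\uparrow}(u)\Big)^2du=\tfrac{K^2\varepsilon}{q_{\min}}$$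 has a unique positive solution $\overline\lambda$, and $$\sup_{Y\in\mathfrak B_\varepsilon(X)}I_h(g(Y))\;\le\;\int_0^1\gamma(u)\big(F^{-1}+\tfrac{1}{2q_{\min}\overline\lambda}\gamma\big)^{\uparrow}(u)\,du .$$ -/

import Mathlib

open MeasureTheory ProbabilityTheory Set
open scoped NNReal ENNReal Matrix

noncomputable section

/-- A probability space is non-atomic: every event of positive measure contains an event of
strictly smaller positive measure. -/
def NonAtomicMeasure {Ω : Type*} [MeasurableSpace Ω] (P : Measure Ω) : Prop :=
  ∀ A, MeasurableSet A → 0 < P A → ∃ B, B ⊆ A ∧ MeasurableSet B ∧ 0 < P B ∧ P B < P A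

/-- The Bregman divergence `φ x - φ y - ∇φ(y) · (x - y)`. -/
def bregmanDiv {E : Type*} [NormedAddCommGroup E] [NormedSpace ℝ E] (φ : E → ℝ) (x y : E) : ℝ :=
  φ x - φ y - fderiv ℝ φ y (x - y)

/-- The joint laws with first marginal `μ` and second marginal `ν`. -/
def couplings {E : Type*} [MeasurableSpace E] (μ ν : Measure E) : Set (Measure (E × E)) :=
  {π | π.map Prod.fst = μ ∧ π.map Prod.snd = ν}

/-- The Bregman-Wasserstein divergence from the law `μ` to the law `ν`: the infimum of
`𝔼[B_φ(X, Y)]` over all couplings. For a convex differentiable `φ` the Bregman divergence is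
non-negative, so that nothing is lost in `ENNReal.ofReal`. -/
def bwDiv {E : Type*} [NormedAddCommGroup E] [NormedSpace ℝ E] [MeasurableSpace E]
    (φ : E → ℝ) (μ ν : Measure E) : ℝ≥0∞ :=
  ⨅ π ∈ couplings μ ν, ∫⁻ z, ENNReal.ofReal (bregmanDiv φ z.1 z.2) ∂π

/-- The Bregman-Wasserstein uncertainty set with tolerance `ε` around the random vector `X`: all
random vectors `Z` on the same probability space with divergence from `Z` to `X` at most `ε`. -/
def bwBall {Ω E : Type*} [MeasurableSpace Ω] [NormedAddCommGroup E] [NormedSpace ℝ E]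
    [MeasurableSpace E] (φ : E → ℝ) (P : Measure Ω) (ε : ℝ) (X : Ω → E) : Set (Ω → E) :=
  {Z | AEMeasurable Z P ∧ bwDiv φ (P.map Z) (P.map X) ≤ ENNReal.ofReal ε}

/-- The quadratic form `x ↦ xᵀ Q x`, the generator of the squared Mahalanobis distance. -/
def quadForm {n : ℕ} (Q : Matrix (Fin n) (Fin n) ℝ) (x : EuclideanSpace ℝ (Fin n)) : ℝ :=
  x.ofLp ⬝ᵥ (Q *ᵥ x.ofLp)

/-- The left-continuous quantile function `F⁻¹(u) = inf {x | F(x) ≥ u}` of the real random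
variable `Y`, where `F` is its cumulative distribution function. -/
def quantile {Ω : Type*} [MeasurableSpace Ω] (P : Measure Ω) (Y : Ω → ℝ) (u : ℝ) : ℝ :=
  sInf {x : ℝ | u ≤ cdf (P.map Y) x}

/-- A distortion function on `[0, 1]`: non-constant, of bounded variation, zero at zero. -/
structure IsDistortion (h : ℝ → ℝ) : Prop where
  zero : h 0 = 0
  boundedVariation : BoundedVariationOn h (Icc 0 1)
  nonconstant : ∃ s ∈ Icc (0 : ℝ) 1, ∃ t ∈ Icc (0 : ℝ) 1, h s ≠ h t

/-- `h` is absolutely continuous on `[0, 1]` and `γ` is its distortion weight function: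
`γ(u)` is the left derivative of `h` at `1 - u`, for almost every `u ∈ (0, 1)`. -/
structure HasDistortionWeight (h γ : ℝ → ℝ) : Prop where
  absolutelyContinuous : AbsolutelyContinuousOnInterval h 0 1
  leftDeriv : ∀ᵐ u ∂(volume.restrict (Ioo (0 : ℝ) 1)),
    HasDerivWithinAt h (γ u) (Iic (1 - u)) (1 - u)

/-- The two integrals that define the signed Choquet integral of `Y` converge. -/
def ChoquetFinite {Ω : Type*} [MeasurableSpace Ω] (h : ℝ → ℝ) (P : Measure Ω) (Y : Ω → ℝ) :
    Prop :=
  IntegrableOn (fun x : ℝ => h (P.real {ω | x ≤ Y ω}) - h 1) (Iio 0) ∧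
    IntegrableOn (fun x : ℝ => h (P.real {ω | x ≤ Y ω})) (Ioi 0)

/-- The signed Choquet integral
`I_h(Y) = ∫_{-∞}^0 [h(P(Y ≥ x)) - h(1)] dx + ∫_0^∞ h(P(Y ≥ x)) dx`. -/
def signedChoquet {Ω : Type*} [MeasurableSpace Ω] (h : ℝ → ℝ) (P : Measure Ω) (Y : Ω → ℝ) : ℝ :=
  (∫ x in Iio (0 : ℝ), (h (P.real {ω | x ≤ Y ω}) - h 1)) +
    ∫ x in Ioi (0 : ℝ), h (P.real {ω | x ≤ Y ω})

/-- The `L²` norm of a function on `(0, 1)`. -/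
def l2Norm (l : ℝ → ℝ) : ℝ := √(∫ u in Ioo (0 : ℝ) 1, l u ^ 2)

/-- The left-continuous, non-decreasing, square integrable functions on `(0, 1)`. -/
def isotonicCone : Set (ℝ → ℝ) :=
  {j | MonotoneOn j (Ioo 0 1) ∧ (∀ u ∈ Ioo (0 : ℝ) 1, ContinuousWithinAt j (Iic u) u) ∧
    MemLp j 2 (volume.restrict (Ioo (0 : ℝ) 1))}

/-- `j` minimizes `∫₀¹ (j(u) - l(u))² du` over the isotonic cone. -/
def IsIsotonicProj (l j : ℝ → ℝ) : Prop :=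
  j ∈ isotonicCone ∧ ∀ k ∈ isotonicCone,
    ∫ u in Ioo (0 : ℝ) 1, (j u - l u) ^ 2 ≤ ∫ u in Ioo (0 : ℝ) 1, (k u - l u) ^ 2

/-- The isotonic projection of `l ∈ L²((0, 1))`: the minimizer, which is unique on `(0, 1)`. -/
def isotonicProj (l : ℝ → ℝ) : ℝ → ℝ := Classical.epsilon (IsIsotonicProj l)

/-- The decomposition `g(x) = g̃(x⁽¹⁾) + βᵀ x⁽²⁾`, where `x⁽¹⁾` is the vector of the first `m`
coordinates of `x` and `x⁽²⁾` the vector of the last `k`. -/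
def HasLinearPart {m k : ℕ} (g : EuclideanSpace ℝ (Fin (m + k)) → ℝ)
    (gt : EuclideanSpace ℝ (Fin m) → ℝ) (β : EuclideanSpace ℝ (Fin k)) : Prop :=
  ∀ x, g x = gt (WithLp.toLp 2 fun i => x (Fin.castAdd k i)) + ∑ j, β j * x (Fin.natAdd m j)

/-- The isotonic projection of `F_Y⁻¹ + γ / (2 q lam)`. -/
def projQuantile {Ω : Type*} [MeasurableSpace Ω] (P : Measure Ω) (Y : Ω → ℝ) (γ : ℝ → ℝ)
    (q lam : ℝ) : ℝ → ℝ :=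
  isotonicProj fun u => quantile P Y u + 1 / (2 * q * lam) * γ u

/-- `lam` is a positive solution of
`∫₀¹ (F_Y⁻¹(u) - (F_Y⁻¹ + γ / (2 q lam))^↑(u))² du = r`. -/
def IsMultiplier {Ω : Type*} [MeasurableSpace Ω] (P : Measure Ω) (Y : Ω → ℝ) (γ : ℝ → ℝ)
    (q r lam : ℝ) : Prop :=
  0 < lam ∧ ∫ u in Ioo (0 : ℝ) 1, (quantile P Y u - projQuantile P Y γ q lam u) ^ 2 = r

end

noncomputable section

open Filter Topology

/-! Everything reduces to the quantile functions of `g(Y)`. Writing `h` as the integral of `γ` and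
exchanging integrals in a layer-cake formula gives `I_h(Y) = ∫ γ F_Y⁻¹` (`choquet_eq`), a linear
functional of the quantile function.

The uncertainty set is then compared with balls around `F⁻¹` in `L²(0,1)`, intersected with the cone
of non-decreasing functions. Outer inclusion (`lintegral_qf_sub_sq_le_of_mem_bwBall`): pushing a
coupling through the Lipschitz map `g` costs a factor `K² / qmin`, and the quantile coupling is the
cheapest on the line. Inner inclusion (`exists_mem_bwBall_qf_eq`): moving `X` along `β` changes
`g(X)` linearly, so every non-decreasing `G` with squared distance at most `‖β‖² ε / qmax` from
`F⁻¹` is attained; non-atomicity realizes the required law on `Ω`.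

It remains to maximize `⟪γ, ·⟫` over cone and ball. Cauchy-Schwarz bounds the gain by radius times
`‖γ‖₂`. If `γ` is non-decreasing, `F⁻¹ + cγ` stays in the cone and attains this bound. If only `γ ≥
0`, the maximizer is the projection of a point `F⁻¹ + sγ` onto the cone, with `s` fixed by the
radius (`IsProjOn.inner_le`, `exists_unique_projection_radius`).

In part (i) `F⁻¹` need not be square integrable: only differences of quantile functions are, and the
integrability of `γ F⁻¹` is extracted from the finiteness of `I_h(g(X))` (`integrable_mul_qf`). -/

/-- The uniform distribution on `(0, 1)`. -/
abbrev unif : Measure ℝ := volume.restrict (Ioo (0 : ℝ) 1)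

/-! ### Uniform law and quantile functions -/

instance : IsProbabilityMeasure unif := ⟨by simp⟩

theorem unif_Ioc {a b : ℝ} (ha : 0 ≤ a) (hb : b ≤ 1) : unif (Ioc a b) = ENNReal.ofReal (b - a) := by
  rw [unif, Measure.restrict_congr_set Ioo_ae_eq_Ioc,
    Measure.restrict_apply measurableSet_Ioc,
    inter_eq_left.2 (Ioc_subset_Ioc ha hb), Real.volume_Ioc]

theorem unif_Iic {t : ℝ} (h1 : t ≤ 1) : unif (Iic t) = ENNReal.ofReal t := by
  have key : unif (Ioc 0 t) = ENNReal.ofReal t := by rw [unif_Ioc le_rfl h1, sub_zero]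
  rw [← key]
  refine measure_congr ?_
  filter_upwards [ae_restrict_mem (μ := volume) (measurableSet_Ioo (a := (0 : ℝ)) (b := 1))]
    with u hu
  exact propext ⟨fun h => ⟨hu.1, h⟩, fun h => h.2⟩

theorem unif_real_Iic {t : ℝ} (h0 : 0 ≤ t) (h1 : t ≤ 1) : unif.real (Iic t) = t := by
  rw [measureReal_def, unif_Iic h1, ENNReal.toReal_ofReal h0]

/-- The left-continuous quantile function of a law on the real line. -/
def qf (μ : Measure ℝ) (u : ℝ) : ℝ := sInf {x : ℝ | u ≤ cdf μ x}

/-- Right continuity of the distribution function puts the infimum into the set; `0 < u < 1` makes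
the set non-empty and bounded below. The other properties of `qf` come from this Galois connection.
-/
theorem qf_le_iff {μ : Measure ℝ} {u : ℝ} (hu : u ∈ Ioo (0 : ℝ) 1) (x : ℝ) :
    qf μ u ≤ x ↔ u ≤ cdf μ x := by
  have hne : {x : ℝ | u ≤ cdf μ x}.Nonempty :=
    ((tendsto_cdf_atTop μ).eventually (eventually_ge_nhds hu.2)).exists
  have hbdd : BddBelow {x : ℝ | u ≤ cdf μ x} := by
    obtain ⟨b, hb⟩ := ((tendsto_cdf_atBot μ).eventually (eventually_lt_nhds hu.1)).exists
    refine ⟨b, fun x hx => ?_⟩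
    by_contra! hxb
    exact absurd ((monotone_cdf μ) hxb.le) (not_le.2 (hb.trans_le hx))
  refine ⟨fun h => ?_, fun h => csInf_le hbdd h⟩
  have hlim : Tendsto (cdf μ) (𝓝[>] x) (𝓝 (cdf μ x)) :=
    ((cdf μ).right_continuous x).mono Ioi_subset_Ici_self
  refine ge_of_tendsto hlim ?_
  filter_upwards [self_mem_nhdsWithin] with y hy
  obtain ⟨z, hz, hzy⟩ := exists_lt_of_csInf_lt hne (h.trans_lt hy)
  exact le_trans hz (monotone_cdf μ hzy.le)

theorem lt_qf_iff {μ : Measure ℝ} {u : ℝ} (hu : u ∈ Ioo (0 : ℝ) 1) (x : ℝ) :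
    x < qf μ u ↔ cdf μ x < u := by
  rw [← not_le, qf_le_iff hu, not_le]

theorem qf_monotoneOn (μ : Measure ℝ) : MonotoneOn (qf μ) (Ioo 0 1) := fun _ hu _ hv huv =>
  (qf_le_iff hu _).2 (huv.trans ((qf_le_iff hv _).1 le_rfl))

theorem qf_leftContinuous (μ : Measure ℝ) {u : ℝ} (hu : u ∈ Ioo (0 : ℝ) 1) :
    ContinuousWithinAt (qf μ) (Iic u) u := by
  have hmem : ∀ᶠ v in 𝓝[≤] u, v ∈ Ioo (0 : ℝ) 1 :=
    nhdsWithin_le_nhds (Ioo_mem_nhds hu.1 hu.2)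
  refine tendsto_order.2 ⟨fun a ha => ?_, fun b hb => ?_⟩
  · have h := (lt_qf_iff hu a).1 ha
    filter_upwards [hmem, nhdsWithin_le_nhds (Ioi_mem_nhds h)] with v hv hav
    exact (lt_qf_iff hv a).2 hav
  · filter_upwards [hmem, self_mem_nhdsWithin] with v hv hvu
    exact (qf_monotoneOn μ hv hu hvu).trans_lt hb

theorem aemeasurable_qf (μ : Measure ℝ) : AEMeasurable (qf μ) unif :=
  aemeasurable_restrict_of_monotoneOn measurableSet_Ioo (qf_monotoneOn μ)

theorem map_qf (μ : Measure ℝ) [IsProbabilityMeasure μ] : unif.map (qf μ) = μ := by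
  have : IsProbabilityMeasure (unif.map (qf μ)) :=
    Measure.isProbabilityMeasure_map (aemeasurable_qf μ)
  refine Measure.ext_of_Iic _ _ fun x => ?_
  rw [Measure.map_apply_of_aemeasurable (aemeasurable_qf μ) measurableSet_Iic, ← ofReal_cdf μ x]
  have h1 : unif (qf μ ⁻¹' Iic x) = unif (Iic (cdf μ x)) := by
    refine measure_congr ?_
    filter_upwards [ae_restrict_mem (μ := volume) (measurableSet_Ioo (a := (0 : ℝ)) (b := 1))]
      with u hu
    exact propext (qf_le_iff hu x)
  rw [h1, unif_Iic (cdf_le_one μ x)]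

/-- With `q` the quantile function of the law of `G`, `q u ≤ G u ≤ q v` for `u ∈ S` and `v > u`, so
the two agree wherever `q` is continuous, that is, off a countable set. Monotonicity is asked only
on a set of full measure so that the result applies to classes in `L²`. -/
theorem qf_map_ae_eq {G : ℝ → ℝ} (hG : AEMeasurable G unif) {S : Set ℝ} (hS : ∀ᵐ u ∂unif, u ∈ S)
    (hmono : MonotoneOn G S) : qf (unif.map G) =ᵐ[unif] G := by
  set q := qf (unif.map G) with hq
  have : IsProbabilityMeasure (unif.map G) := Measure.isProbabilityMeasure_map hG
  have hI : ∀ᵐ u ∂unif, u ∈ Ioo (0 : ℝ) 1 := ae_restrict_mem measurableSet_Ioo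
  have hcdf : ∀ x, cdf (unif.map G) x = unif.real {u | G u ≤ x} := fun x => by
    rw [cdf_eq_real, measureReal_def, Measure.map_apply_of_aemeasurable hG measurableSet_Iic]
    rfl
  have h1 : ∀ u ∈ S, u ∈ Ioo (0 : ℝ) 1 → q u ≤ G u := fun u huS hu => by
    rw [hq, qf_le_iff hu, hcdf]
    have : unif.real (Iic u) ≤ unif.real {v | G v ≤ G u} := by
      refine ENNReal.toReal_mono (measure_ne_top _ _) (measure_mono_ae ?_)
      filter_upwards [hS] with v hv hvu
      exact hmono hv huS hvu
    rwa [unif_real_Iic hu.1.le hu.2.le] at this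
  have h2 : ∀ u ∈ S, u ∈ Ioo (0 : ℝ) 1 → ∀ v ∈ Ioo u 1, G u ≤ q v := fun u huS hu v hv => by
    by_contra! hlt
    have hv' : v ∈ Ioo (0 : ℝ) 1 := ⟨hu.1.trans hv.1, hv.2⟩
    have h3 := (qf_le_iff hv' _).1 (le_refl (q v))
    rw [hcdf] at h3
    have : unif.real {w | G w ≤ q v} ≤ unif.real (Iic u) := by
      refine ENNReal.toReal_mono (measure_ne_top _ _) (measure_mono_ae ?_)
      filter_upwards [hS] with w hw hwv
      by_contra huw
      replace huw : u < w := not_le.1 huw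
      exact absurd (hmono huS hw huw.le) (not_le.2 (lt_of_le_of_lt hwv hlt))
    rw [unif_real_Iic hu.1.le hu.2.le] at this
    linarith [hv.1]
  have hcount := (qf_monotoneOn (unif.map G)).countable_not_continuousWithinAt
  have hc : ∀ᵐ u ∂unif, u ∉ {x ∈ Ioo (0 : ℝ) 1 | ¬ ContinuousWithinAt q (Ioo 0 1) x} :=
    (hcount.ae_notMem _)
  filter_upwards [hS, hI, hc] with u huS hu hcu
  have hcont : ContinuousWithinAt q (Ioo 0 1) u := by
    by_contra h
    exact hcu ⟨hu, h⟩
  refine le_antisymm (h1 u huS hu) ?_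
  have hcont' : Tendsto q (𝓝[Ioo u 1] u) (𝓝 (q u)) :=
    hcont.mono (Ioo_subset_Ioo_left hu.1.le)
  have : (𝓝[Ioo u 1] u).NeBot := by
    rw [nhdsWithin_Ioo_eq_nhdsGT hu.2]; infer_instance
  exact ge_of_tendsto hcont' (by filter_upwards [self_mem_nhdsWithin] with v hv using h2 u huS hu v hv)

/-! ### Optimality of the quantile coupling for the quadratic cost -/

theorem ofReal_sub_sq_eq_volume (a b : ℝ) : ENNReal.ofReal ((a - b) ^ 2) =
    (volume : Measure (ℝ × ℝ)) {z | (b ≤ z.1 ∧ z.1 < a) ∧ (b ≤ z.2 ∧ z.2 < a)} +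
    (volume : Measure (ℝ × ℝ)) {z | (a ≤ z.1 ∧ z.1 < b) ∧ (a ≤ z.2 ∧ z.2 < b)} := by
  have key : ∀ c d : ℝ, (volume : Measure (ℝ × ℝ)) {z | (c ≤ z.1 ∧ z.1 < d) ∧ (c ≤ z.2 ∧ z.2 < d)} =
      ENNReal.ofReal (d - c) * ENNReal.ofReal (d - c) := fun c d => by
    have : {z : ℝ × ℝ | (c ≤ z.1 ∧ z.1 < d) ∧ (c ≤ z.2 ∧ z.2 < d)} = Ico c d ×ˢ Ico c d := rfl
    rw [this, Measure.volume_eq_prod, Measure.prod_prod, Real.volume_Ico]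
  rw [key, key]
  rcases le_total a b with h | h
  · rw [ENNReal.ofReal_of_nonpos (sub_nonpos.2 h), zero_mul, zero_add,
      ← ENNReal.ofReal_mul (sub_nonneg.2 h)]
    congr 1; ring
  · rw [ENNReal.ofReal_of_nonpos (sub_nonpos.2 h), zero_mul, add_zero,
      ← ENNReal.ofReal_mul (sub_nonneg.2 h)]
    congr 1; ring

/-- The expected squared difference as an integral of joint distribution functions. -/
theorem lintegral_sub_sq_eq (ρ : Measure (ℝ × ℝ)) [SFinite ρ] :
    ∫⁻ w, ENNReal.ofReal ((w.1 - w.2) ^ 2) ∂ρ =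
      (∫⁻ z : ℝ × ℝ, ρ {w | w.2 ≤ min z.1 z.2 ∧ max z.1 z.2 < w.1}) +
      ∫⁻ z : ℝ × ℝ, ρ {w | w.1 ≤ min z.1 z.2 ∧ max z.1 z.2 < w.2} := by
  have key : ∀ f g : ℝ × ℝ → ℝ, Measurable f → Measurable g →
      Measurable (fun w => (volume : Measure (ℝ × ℝ))
        {z | (g w ≤ z.1 ∧ z.1 < f w) ∧ (g w ≤ z.2 ∧ z.2 < f w)}) ∧
      ∫⁻ w, (volume : Measure (ℝ × ℝ))
        {z | (g w ≤ z.1 ∧ z.1 < f w) ∧ (g w ≤ z.2 ∧ z.2 < f w)} ∂ρ =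
      ∫⁻ z : ℝ × ℝ, ρ {w | g w ≤ min z.1 z.2 ∧ max z.1 z.2 < f w} := fun f g hf hg => by
    have hs : MeasurableSet {x : (ℝ × ℝ) × (ℝ × ℝ) |
        (g x.1 ≤ x.2.1 ∧ x.2.1 < f x.1) ∧ (g x.1 ≤ x.2.2 ∧ x.2.2 < f x.1)} := by
      refine (MeasurableSet.inter ?_ ?_).inter (MeasurableSet.inter ?_ ?_)
      · exact measurableSet_le (hg.comp measurable_fst) (measurable_fst.comp measurable_snd)
      · exact measurableSet_lt (measurable_fst.comp measurable_snd) (hf.comp measurable_fst)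
      · exact measurableSet_le (hg.comp measurable_fst) (measurable_snd.comp measurable_snd)
      · exact measurableSet_lt (measurable_snd.comp measurable_snd) (hf.comp measurable_fst)
    refine ⟨measurable_measure_prodMk_left hs, ?_⟩
    have h1 := Measure.prod_apply (μ := ρ) (ν := (volume : Measure (ℝ × ℝ))) hs
    have h2 := Measure.prod_apply_symm (μ := ρ) (ν := (volume : Measure (ℝ × ℝ))) hs
    refine (h1.symm.trans h2).trans (lintegral_congr fun z => ?_)
    congr 1
    ext w
    simp only [mem_preimage, mem_ofPred_eq, le_min_iff, max_lt_iff]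
    tauto
  simp_rw [ofReal_sub_sq_eq_volume]
  rw [lintegral_add_left (key Prod.fst Prod.snd measurable_fst measurable_snd).1,
    (key Prod.fst Prod.snd measurable_fst measurable_snd).2,
    (key Prod.snd Prod.fst measurable_snd measurable_fst).2]

/-- Both conditions cut out intervals in `u`, which intersect in `(cdf ν t, cdf μ s]`. The quantile
coupling thus attains the lower bound of `ofReal_cdf_sub_le`, valid for every coupling, at all
levels at once. -/
theorem unif_qf_le_lt_qf (μ ν : Measure ℝ) (s t : ℝ) :
    unif {u | qf μ u ≤ s ∧ t < qf ν u} = ENNReal.ofReal (cdf μ s - cdf ν t) := by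
  rw [← unif_Ioc (cdf_nonneg ν t) (cdf_le_one μ s)]
  refine measure_congr ?_
  filter_upwards [ae_restrict_mem (μ := volume) (measurableSet_Ioo (a := (0 : ℝ)) (b := 1))]
    with u hu
  refine propext ((and_congr (qf_le_iff hu s) (lt_qf_iff hu t)).trans and_comm)

theorem ofReal_cdf_sub_le (π : Measure (ℝ × ℝ)) [IsProbabilityMeasure π] {f g : ℝ × ℝ → ℝ}
    (hf : Measurable f) (hg : Measurable g) (s t : ℝ) :
    ENNReal.ofReal (cdf (π.map f) s - cdf (π.map g) t) ≤ π {w | f w ≤ s ∧ t < g w} := by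
  have := Measure.isProbabilityMeasure_map (μ := π) hf.aemeasurable
  have := Measure.isProbabilityMeasure_map (μ := π) hg.aemeasurable
  rw [ENNReal.ofReal_sub _ (cdf_nonneg _ _), ofReal_cdf, ofReal_cdf,
    Measure.map_apply hf measurableSet_Iic, Measure.map_apply hg measurableSet_Iic]
  refine le_measure_sdiff.trans (measure_mono ?_)
  exact fun w hw => ⟨hw.1, not_le.1 hw.2⟩

/-- The quantile coupling minimizes the quadratic cost among all couplings. -/
theorem lintegral_qf_sub_sq_le {Ω : Type*} [MeasurableSpace Ω] (π : Measure Ω)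
    [IsProbabilityMeasure π] {A B : Ω → ℝ} (hA : Measurable A) (hB : Measurable B) :
    ∫⁻ u, ENNReal.ofReal ((qf (π.map A) u - qf (π.map B) u) ^ 2) ∂unif ≤
      ∫⁻ ω, ENNReal.ofReal ((A ω - B ω) ^ 2) ∂π := by
  set ρ := π.map fun ω => (A ω, B ω) with hρ
  have : IsProbabilityMeasure ρ := Measure.isProbabilityMeasure_map (by fun_prop)
  have hA' : π.map A = ρ.map Prod.fst := by
    rw [hρ, Measure.map_map measurable_fst (by fun_prop)]; rfl
  have hB' : π.map B = ρ.map Prod.snd := by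
    rw [hρ, Measure.map_map measurable_snd (by fun_prop)]; rfl
  have hm : AEMeasurable (fun u => (qf (π.map A) u, qf (π.map B) u)) unif :=
    (aemeasurable_qf _).prodMk (aemeasurable_qf _)
  have hsq : Measurable fun w : ℝ × ℝ => ENNReal.ofReal ((w.1 - w.2) ^ 2) := by fun_prop
  have hR : ∫⁻ ω, ENNReal.ofReal ((A ω - B ω) ^ 2) ∂π =
      ∫⁻ w, ENNReal.ofReal ((w.1 - w.2) ^ 2) ∂ρ := by
    rw [hρ, lintegral_map hsq (by fun_prop)]
  have hL : ∫⁻ u, ENNReal.ofReal ((qf (π.map A) u - qf (π.map B) u) ^ 2) ∂unif =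
      ∫⁻ w, ENNReal.ofReal ((w.1 - w.2) ^ 2)
        ∂(unif.map fun u => (qf (π.map A) u, qf (π.map B) u)) := by
    rw [lintegral_map' hsq.aemeasurable hm]
  have hset : ∀ (f g : ℝ × ℝ → ℝ), Measurable f → Measurable g → ∀ s t : ℝ,
      MeasurableSet {w | f w ≤ s ∧ t < g w} := fun f g hf hg s t =>
    (measurableSet_le hf measurable_const).inter (measurableSet_lt measurable_const hg)
  have := Measure.isProbabilityMeasure_map hm
  rw [hR, hL, lintegral_sub_sq_eq, lintegral_sub_sq_eq]
  refine add_le_add (lintegral_mono fun z => ?_) (lintegral_mono fun z => ?_)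
  · rw [Measure.map_apply_of_aemeasurable hm (hset _ _ measurable_snd measurable_fst _ _)]
    refine (unif_qf_le_lt_qf _ _ _ _).trans_le ?_
    rw [hA', hB']
    exact ofReal_cdf_sub_le ρ measurable_snd measurable_fst _ _
  · rw [Measure.map_apply_of_aemeasurable hm (hset _ _ measurable_fst measurable_snd _ _)]
    refine (unif_qf_le_lt_qf _ _ _ _).trans_le ?_
    rw [hA', hB']
    exact ofReal_cdf_sub_le ρ measurable_fst measurable_snd _ _

/-! ### Realizing laws on a non-atomic space -/

/-- On a non-atomic probability space there is a random variable whose law has no atoms: one that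
minimizes the probability that two independent copies agree. -/
theorem exists_measurable_noAtoms {Ω : Type*} [MeasurableSpace Ω] (P : Measure Ω)
    [IsProbabilityMeasure P] (hP : NonAtomicMeasure P) :
    ∃ f : Ω → ℝ, Measurable f ∧ ∀ c, P (f ⁻¹' {c}) = 0 := by
  set m : (Ω → ℝ) → ℝ≥0∞ := fun f => (P.prod P) {x | f x.1 = f x.2} with hm
  set I : ℝ≥0∞ := ⨅ f : {f : Ω → ℝ // Measurable f}, m f with hI
  have hIle : ∀ f, Measurable f → I ≤ m f := fun f hf =>
    iInf_le (fun f : {f : Ω → ℝ // Measurable f} => m f) ⟨f, hf⟩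
  have hItop : I ≠ ⊤ := ((hIle _ measurable_const).trans_lt (measure_lt_top _ {x | (0 : ℝ) = 0})).ne
  have hseq : ∀ n : ℕ, ∃ f : Ω → ℝ, Measurable f ∧ m f < I + ((n : ℝ≥0∞) + 1)⁻¹ := fun n => by
    have h0 : ((n : ℝ≥0∞) + 1)⁻¹ ≠ 0 := ENNReal.inv_ne_zero.2 (by finiteness)
    obtain ⟨f, hf⟩ := iInf_lt_iff.1 (ENNReal.lt_add_right hItop h0)
    exact ⟨f, f.2, hf⟩
  choose f hfm hf using hseq
  -- Coding a minimizing sequence into one real variable separates all pairs that some `f n`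
  -- separates, so the infimum is attained.
  set F : Ω → ℝ := fun ω => embeddingReal (ℕ → ℝ) fun n => f n ω with hF
  have hFm : Measurable F :=
    (measurableEmbedding_embeddingReal (ℕ → ℝ)).measurable.comp (measurable_pi_lambda _ hfm)
  have hFle : m F ≤ I := by
    have hn : ∀ n : ℕ, m F ≤ I + ((n : ℝ≥0∞) + 1)⁻¹ := fun n => by
      refine le_trans (measure_mono fun x hx => ?_) (hf n).le
      exact congrFun ((measurableEmbedding_embeddingReal (ℕ → ℝ)).injective hx) n
    have hlim : Tendsto (fun n : ℕ => I + ((n : ℝ≥0∞) + 1)⁻¹) atTop (𝓝 (I + 0)) := by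
      refine Tendsto.const_add _ ?_
      have := (tendsto_add_atTop_iff_nat 1).2 ENNReal.tendsto_inv_nat_nhds_zero
      simpa using this
    rw [add_zero] at hlim
    exact ge_of_tendsto' hlim hn
  refine ⟨F, hFm, fun c => ?_⟩
  by_contra hc
  obtain ⟨B, hBA, hBm, hB0, hBlt⟩ := hP (F ⁻¹' {c}) (hFm (measurableSet_singleton c))
    (pos_iff_ne_zero.2 hc)
  have hdiff : P (F ⁻¹' {c} \ B) ≠ 0 := fun h0 => by
    have := measure_le_inter_add_sdiff P (F ⁻¹' {c}) B
    rw [h0, add_zero] at this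
    exact absurd (this.trans (measure_mono inter_subset_right)) (not_le.2 hBlt)
  -- Adjoining the indicator of `B` splits the atom: pairs in `B ×ˢ (F ⁻¹' {c} \ B)`, of positive
  -- mass, no longer agree, against minimality.
  set F' : Ω → ℝ := fun ω => embeddingReal (ℝ × ℝ) (F ω, B.indicator 1 ω) with hF'
  have hF'm : Measurable F' := (measurableEmbedding_embeddingReal (ℝ × ℝ)).measurable.comp
    (hFm.prodMk (measurable_one.indicator hBm))
  have hinj : ∀ a b, F' a = F' b → F a = F b ∧ (B.indicator 1 a : ℝ) = B.indicator 1 b :=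
    fun a b h => Prod.ext_iff.1 ((measurableEmbedding_embeddingReal (ℝ × ℝ)).injective h)
  have hdisj : Disjoint {x : Ω × Ω | F' x.1 = F' x.2} (B ×ˢ (F ⁻¹' {c} \ B)) := by
    rw [Set.disjoint_left]
    rintro x hx ⟨h1, h2⟩
    have := (hinj _ _ hx).2
    rw [indicator_of_mem h1, indicator_of_notMem h2.2] at this
    exact one_ne_zero this
  have hsum : m F' + P B * P (F ⁻¹' {c} \ B) ≤ m F := by
    rw [← Measure.prod_prod, hm, ← measure_union hdisj
      (hBm.prod ((hFm (measurableSet_singleton c)).diff hBm))]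
    refine measure_mono (union_subset (fun x hx => (hinj _ _ hx).1) ?_)
    rintro x ⟨h1, h2⟩
    exact (hBA h1).trans h2.1.symm
  have hlt : m F' < m F' + P B * P (F ⁻¹' {c} \ B) :=
    ENNReal.lt_add_right (measure_ne_top _ _) (mul_ne_zero hB0.ne' hdiff)
  exact absurd (hIle F' hF'm) (not_le.2 (hlt.trans_le (hsum.trans hFle)))

/-- Without atoms the distribution function is also left continuous, and to the left of `qf ν u` its
values are below `u`. -/
theorem cdf_qf {ν : Measure ℝ} [IsProbabilityMeasure ν] (hν : ∀ c, ν {c} = 0) {u : ℝ}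
    (hu : u ∈ Ioo (0 : ℝ) 1) : cdf ν (qf ν u) = u := by
  refine le_antisymm ?_ ((qf_le_iff hu _).1 le_rfl)
  have h1 := (cdf ν).measure_singleton (qf ν u)
  rw [measure_cdf, hν, eq_comm, ENNReal.ofReal_eq_zero, sub_nonpos] at h1
  refine h1.trans (le_of_tendsto ((cdf ν).mono.tendsto_leftLim (qf ν u)) ?_)
  filter_upwards [self_mem_nhdsWithin] with x hx using ((lt_qf_iff hu x).1 hx).le

/-- The probability integral transform. To find its law, `f` is replaced by the quantile transform
of a uniform variable, which the distribution function undoes. -/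
theorem exists_map_eq_unif {Ω : Type*} [MeasurableSpace Ω] (P : Measure Ω)
    [IsProbabilityMeasure P] (hP : NonAtomicMeasure P) :
    ∃ U : Ω → ℝ, Measurable U ∧ P.map U = unif := by
  obtain ⟨f, hf, hf0⟩ := exists_measurable_noAtoms P hP
  have := Measure.isProbabilityMeasure_map (μ := P) hf.aemeasurable
  have hcdf : Measurable (cdf (P.map f)) := (monotone_cdf _).measurable
  refine ⟨fun ω => cdf (P.map f) (f ω), hcdf.comp hf, ?_⟩
  have h1 : P.map (fun ω => cdf (P.map f) (f ω)) = (P.map f).map (cdf (P.map f)) :=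
    (Measure.map_map hcdf hf).symm
  have h2 : (P.map f).map (cdf (P.map f)) =
      unif.map (fun u => cdf (P.map f) (qf (P.map f) u)) := by
    conv_lhs => arg 2; rw [← map_qf (P.map f)]
    exact AEMeasurable.map_map_of_aemeasurable hcdf.aemeasurable (aemeasurable_qf _)
  have h3 : (fun u => cdf (P.map f) (qf (P.map f) u)) =ᵐ[unif] id := by
    filter_upwards [ae_restrict_mem (μ := volume) (measurableSet_Ioo (a := (0 : ℝ)) (b := 1))]
      with u hu
    refine cdf_qf (fun c => ?_) hu
    rw [Measure.map_apply hf (measurableSet_singleton c), hf0]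
  rw [h1, h2, Measure.map_congr h3, Measure.map_id]

/-- Every Borel law is the law of a random element on a non-atomic probability space. -/
theorem exists_map_eq {Ω : Type*} [MeasurableSpace Ω] (P : Measure Ω)
    [IsProbabilityMeasure P] (hP : NonAtomicMeasure P) {E : Type*} [MeasurableSpace E]
    [StandardBorelSpace E] [Nonempty E] (μ : Measure E) [IsProbabilityMeasure μ] :
    ∃ Y : Ω → E, AEMeasurable Y P ∧ P.map Y = μ := by
  obtain ⟨U, hU, hPU⟩ := exists_map_eq_unif P hP
  have he := measurableEmbedding_embeddingReal E
  -- `d` is a measurable left inverse of the embedding of `E` into the line: the image law is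
  -- sampled by its quantile function and decoded by `d`.
  obtain ⟨d, hd, hde⟩ := he.exists_measurable_extend measurable_id fun _ => inferInstance
  have := Measure.isProbabilityMeasure_map (μ := μ) he.measurable.aemeasurable
  have hq : AEMeasurable (qf (μ.map (embeddingReal E))) (P.map U) := hPU ▸ aemeasurable_qf _
  have hdq : AEMeasurable (fun u => d (qf (μ.map (embeddingReal E)) u)) (P.map U) :=
    hd.comp_aemeasurable hq
  refine ⟨fun ω => d (qf (μ.map (embeddingReal E)) (U ω)), hdq.comp_measurable hU, ?_⟩
  have h1 := AEMeasurable.map_map_of_aemeasurable hdq hU.aemeasurable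
  have h2 := AEMeasurable.map_map_of_aemeasurable hd.aemeasurable hq
  rw [hPU, map_qf, Measure.map_map hd he.measurable, hde, Measure.map_id] at h2
  rw [hPU] at h1
  exact h1.symm.trans h2.symm

/-! ### Layer-cake formula for `∫ γ Q⁺` -/

/-- The set `s` of pairs lies between the strict and the non-strict order relation. -/
structure IsOrderRel (s : Set (ℝ × ℝ)) : Prop where
  measurable : MeasurableSet s
  mem_of_lt : ∀ x y, x < y → (x, y) ∈ s
  le_of_mem : ∀ x y, (x, y) ∈ s → x ≤ y

/-- Both relations occur: `x ≤ q` for the positive part, and for the negative part the complement of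
`-x ≤ q`, which is `x < -q`. -/
theorem isOrderRel_le : IsOrderRel {z | z.1 ≤ z.2} :=
  ⟨measurableSet_le measurable_fst measurable_snd, fun _ _ h => h.le, fun _ _ h => h⟩

theorem isOrderRel_lt : IsOrderRel {z | z.1 < z.2} :=
  ⟨measurableSet_lt measurable_fst measurable_snd, fun _ _ h => h, fun _ _ h => le_of_lt h⟩

/-- The integrand of the layer-cake representation of `∫ γ Q⁺`. -/
def layer (s : Set (ℝ × ℝ)) (Q γ : ℝ → ℝ) (z : ℝ × ℝ) : ℝ :=
  {u | (z.1, Q u) ∈ s}.indicator γ z.2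

section Layer

variable {s : Set (ℝ × ℝ)} {ρ : Measure ℝ} {Q γ : ℝ → ℝ}

theorem IsOrderRel.volume_section (hs : IsOrderRel s) (y : ℝ) :
    (volume.restrict (Ioi 0)) {x | (x, y) ∈ s} = ENNReal.ofReal y := by
  have hm : MeasurableSet {x | (x, y) ∈ s} := measurable_prodMk_right hs.measurable
  rw [Measure.restrict_apply hm]
  refine le_antisymm ?_ ?_
  · refine (measure_mono (t := Ioc 0 y) fun x hx => ⟨hx.2, hs.le_of_mem _ _ hx.1⟩).trans ?_
    rw [Real.volume_Ioc, sub_zero]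
  · refine le_trans ?_ (measure_mono (s := Ioo 0 y) fun x hx => ⟨hs.mem_of_lt _ _ hx.2, hx.1⟩)
    rw [Real.volume_Ioo, sub_zero]

theorem IsOrderRel.integral_layer_left (hs : IsOrderRel s) (u : ℝ) :
    ∫ x in Ioi 0, layer s Q γ (x, u) = γ u * max (Q u) 0 := by
  have hm : MeasurableSet {x | (x, Q u) ∈ s} := measurable_prodMk_right hs.measurable
  have h1 : ∀ x, layer s Q γ (x, u) = {x | (x, Q u) ∈ s}.indicator (fun _ => γ u) x := fun x => rfl
  simp_rw [h1]
  rw [integral_indicator_const _ hm, measureReal_def, hs.volume_section, smul_eq_mul, mul_comm,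
    ENNReal.toReal_ofReal']

theorem norm_layer (z : ℝ × ℝ) : ‖layer s Q γ z‖ = layer s Q (fun u => ‖γ u‖) z :=
  norm_indicator_eq_indicator_norm _ _

theorem IsOrderRel.aestronglyMeasurable_layer (hs : IsOrderRel s) [SFinite ρ]
    (hγ : AEStronglyMeasurable γ ρ) (hQ : AEMeasurable Q ρ) :
    AEStronglyMeasurable (layer s Q γ) ((volume.restrict (Ioi 0)).prod ρ) := by
  have h1 : AEMeasurable (fun z : ℝ × ℝ => (z.1, Q z.2)) ((volume.restrict (Ioi 0)).prod ρ) :=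
    measurable_fst.aemeasurable.prodMk hQ.comp_snd
  exact hγ.comp_snd.indicator₀ (h1.nullMeasurableSet_preimage hs.measurable)

theorem IsOrderRel.integrable_layer_iff (hs : IsOrderRel s) [SFinite ρ]
    (hγ : AEStronglyMeasurable γ ρ) (hQ : AEMeasurable Q ρ) :
    Integrable (layer s Q γ) ((volume.restrict (Ioi 0)).prod ρ) ↔
      Integrable (fun u => γ u * max (Q u) 0) ρ := by
  refine ⟨fun h => ?_, fun h => ?_⟩
  · exact h.integral_prod_right.congr (ae_of_all _ fun u => hs.integral_layer_left u)
  · rw [integrable_prod_iff' (hs.aestronglyMeasurable_layer hγ hQ)]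
    refine ⟨ae_of_all _ fun u => ?_, ?_⟩
    · have hm : MeasurableSet {x | (x, Q u) ∈ s} := measurable_prodMk_right hs.measurable
      refine IntegrableOn.integrable_indicator (f := fun _ : ℝ => γ u) ?_ hm
      refine integrableOn_const ?_
      exact (hs.volume_section (Q u)).trans_ne ENNReal.ofReal_ne_top
    · refine h.norm.congr (ae_of_all _ fun u => ?_)
      simp_rw [norm_layer, hs.integral_layer_left]
      rw [norm_mul, Real.norm_of_nonneg (le_max_right (Q u) 0)]

theorem IsOrderRel.integrable_integral_layer (hs : IsOrderRel s) [SFinite ρ]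
    (hγ : AEStronglyMeasurable γ ρ) (hQ : AEMeasurable Q ρ)
    (h : Integrable (fun u => γ u * max (Q u) 0) ρ) :
    IntegrableOn (fun x => ∫ u, layer s Q γ (x, u) ∂ρ) (Ioi 0) ∧
      ∫ x in Ioi 0, ∫ u, layer s Q γ (x, u) ∂ρ = ∫ u, γ u * max (Q u) 0 ∂ρ := by
  have hl := (hs.integrable_layer_iff hγ hQ).2 h
  refine ⟨hl.integral_prod_left, ?_⟩
  rw [← integral_prod _ hl, integral_prod_symm _ hl]
  simp_rw [hs.integral_layer_left]

/-- A converse to Fubini, which needs absence of cancellation in the inner integrals. This is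
assumed above the level `x₀`; the levels in `(0, x₀]` have finite length and contribute at most `∫
‖γ‖` each. -/
theorem IsOrderRel.integrable_of_integral_layer (hs : IsOrderRel s) [SFinite ρ]
    (hγ : Integrable γ ρ) (hQ : AEMeasurable Q ρ) {x₀ : ℝ}
    (hx₀ : ∀ x, x₀ < x → ∫ u, ‖layer s Q γ (x, u)‖ ∂ρ ≤ ‖∫ u, layer s Q γ (x, u) ∂ρ‖)
    (h : IntegrableOn (fun x => ∫ u, layer s Q γ (x, u) ∂ρ) (Ioi 0)) :
    Integrable (fun u => γ u * max (Q u) 0) ρ := by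
  have hmeas := hs.aestronglyMeasurable_layer hγ.1 hQ
  have hle : ∀ x u, ‖layer s Q γ (x, u)‖ ≤ ‖γ u‖ := fun x u => norm_indicator_le_norm_self _ _
  have hsec : ∀ x, Integrable (fun u => layer s Q γ (x, u)) ρ := fun x => by
    have hpre : NullMeasurableSet {u | (x, Q u) ∈ s} ρ :=
      (aemeasurable_const.prodMk hQ).nullMeasurableSet_preimage hs.measurable
    exact hγ.mono (hγ.1.indicator₀ hpre) (ae_of_all _ fun u => hle x u)
  rw [← hs.integrable_layer_iff hγ.1 hQ, integrable_prod_iff hmeas]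
  refine ⟨ae_of_all _ hsec, ?_⟩
  have hbound : IntegrableOn (fun x => ‖∫ u, layer s Q γ (x, u) ∂ρ‖ +
      (Iic x₀).indicator (fun _ => ∫ u, ‖γ u‖ ∂ρ) x) (Ioi 0) := by
    refine h.norm.add (IntegrableOn.integrable_indicator ?_ measurableSet_Iic)
    refine integrableOn_const ?_
    rw [Measure.restrict_apply measurableSet_Iic]
    exact ((measure_mono (t := Ioc 0 x₀) fun x hx => ⟨hx.2, hx.1⟩).trans_lt measure_Ioc_lt_top).ne
  refine Integrable.mono hbound hmeas.norm.integral_prod_right' (ae_of_all _ fun x => ?_)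
  have h0 : 0 ≤ ∫ u, ‖layer s Q γ (x, u)‖ ∂ρ := integral_nonneg fun u => norm_nonneg _
  have h1 : 0 ≤ ∫ u, ‖γ u‖ ∂ρ := integral_nonneg fun u => norm_nonneg _
  rw [Real.norm_of_nonneg h0, Real.norm_of_nonneg
    (add_nonneg (norm_nonneg _) (indicator_nonneg (fun _ _ => h1) _))]
  rcases lt_or_ge x₀ x with hx | hx
  · rw [indicator_of_notMem (by simpa using hx), add_zero]
    exact hx₀ x hx
  · rw [indicator_of_mem (by simpa using hx)]
    exact (integral_mono (hsec x).norm hγ.norm (hle x)).trans (le_add_of_nonneg_left (norm_nonneg _))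

end Layer

/-! ### Quantile representation of the signed Choquet integral -/

/-- The distortion function is recovered from its weight function. -/
theorem HasDistortionWeight.eq_integral {h γ : ℝ → ℝ} (hγ : HasDistortionWeight h γ)
    (h0 : h 0 = 0) {t : ℝ} (ht : t ∈ Icc (0 : ℝ) 1) :
    h t = ∫ u in Ioi (1 - t), γ u ∂unif := by
  have hAC : AbsolutelyContinuousOnInterval h 0 t := by
    refine hγ.absolutelyContinuous.mono ?_
    rw [uIcc_of_le ht.1, uIcc_of_le zero_le_one]
    exact Icc_subset_Icc_right ht.2
  have h1 := hAC.integral_deriv_eq_sub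
  rw [h0, sub_zero] at h1
  have h2 : ∫ u in (1 - t)..1, deriv h (1 - u) = ∫ s in (0 : ℝ)..t, deriv h s := by
    rw [intervalIntegral.integral_comp_sub_left (fun s => deriv h s)]
    simp
  have hdiff : ∀ᵐ u : ℝ, 1 - u ∈ uIcc (0 : ℝ) 1 → DifferentiableAt ℝ h (1 - u) :=
    (Measure.measurePreserving_sub_left volume (1 : ℝ)).quasiMeasurePreserving.ae
      hγ.absolutelyContinuous.ae_differentiableAt
  have hset : Ioi (1 - t) ∩ Ioo 0 1 = Ioo (1 - t) 1 := by
    ext u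
    simp only [mem_inter_iff, mem_Ioi, mem_Ioo]
    exact ⟨fun h => ⟨h.1, h.2.2⟩, fun h => ⟨h.1, by linarith [ht.2], h.2⟩⟩
  rw [← h1, ← h2, intervalIntegral.integral_of_le (by linarith [ht.1]),
    integral_Ioc_eq_integral_Ioo, Measure.restrict_restrict measurableSet_Ioi, hset]
  refine setIntegral_congr_ae measurableSet_Ioo ?_
  have hl := (ae_restrict_iff' measurableSet_Ioo).1 hγ.leftDeriv
  filter_upwards [hdiff, hl] with u hu hlu hut
  have hu01 : u ∈ Ioo (0 : ℝ) 1 := ⟨by linarith [hut.1, ht.2], hut.2⟩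
  have hd := hu (by rw [uIcc_of_le zero_le_one]; constructor <;> linarith [hu01.1, hu01.2])
  -- An absolutely continuous function is differentiable almost everywhere, and there its derivative
  -- is the left derivative `γ u`.
  exact (uniqueDiffWithinAt_Iic (1 - u)).eq_deriv _ hd.hasDerivAt.hasDerivWithinAt (hlu hu01)

/-- A lower set of `(0, 1)` is an initial interval up to a null set. -/
theorem ae_eq_Iic_of_isLower {A : Set ℝ}
    (hA : ∀ u ∈ A, ∀ v ∈ Ioo (0 : ℝ) 1, u ∈ Ioo (0 : ℝ) 1 → v < u → v ∈ A) :
    A =ᵐ[unif] Iic (unif.real A) := by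
  have hI : ∀ᵐ u ∂unif, u ∈ Ioo (0 : ℝ) 1 := ae_restrict_mem measurableSet_Ioo
  have hne : ∀ᵐ u ∂unif, u ≠ unif.real A := Measure.ae_ne _ _
  filter_upwards [hI, hne] with u hu hu'
  refine propext ⟨fun h => ?_, fun h => ?_⟩
  · have h1 : unif.real (Iic u) ≤ unif.real A := by
      refine ENNReal.toReal_mono (measure_ne_top _ _) (measure_mono_ae ?_)
      filter_upwards [hI] with v hv hvu
      rcases eq_or_lt_of_le (show v ≤ u from hvu) with rfl | hlt
      · exact h
      · exact hA u h v hv hu hlt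
    rwa [unif_real_Iic hu.1.le hu.2.le] at h1
  · by_contra hn
    have h1 : unif.real A ≤ unif.real (Iic u) := by
      refine ENNReal.toReal_mono (measure_ne_top _ _) (measure_mono_ae ?_)
      filter_upwards [hI] with v hv hvA
      by_contra hvu
      exact hn (hA v hvA u hu hv (not_le.1 hvu))
    rw [unif_real_Iic hu.1.le hu.2.le] at h1
    exact hu' (le_antisymm h h1)

section Choquet

variable {Ω : Type*} [MeasurableSpace Ω] {P : Measure Ω} [IsProbabilityMeasure P]
  {h γ : ℝ → ℝ} {Y : Ω → ℝ}

/-- `Y` has the law of `q` under the uniform measure, and `{x ≤ q}` is an upper set, hence almost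
everywhere `(1 - t, ∞)` with `t` its mass; `h t` is the integral of `γ` over it. -/
theorem HasDistortionWeight.survival (hγ : HasDistortionWeight h γ) (h0 : h 0 = 0)
    (hY : AEMeasurable Y P) (x : ℝ) :
    h (P.real {ω | x ≤ Y ω}) = ∫ u, layer {z | z.1 ≤ z.2} (qf (P.map Y)) γ (x, u) ∂unif := by
  have := Measure.isProbabilityMeasure_map hY
  set q := qf (P.map Y) with hq
  have hqm : AEMeasurable q unif := aemeasurable_qf _
  have hP : P.real {ω | x ≤ Y ω} = unif.real {u | x ≤ q u} := by
    have h1 : (P.map Y).real (Ici x) = P.real {ω | x ≤ Y ω} := by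
      rw [measureReal_def, Measure.map_apply_of_aemeasurable hY measurableSet_Ici]; rfl
    have h2 : (unif.map q).real (Ici x) = unif.real {u | x ≤ q u} := by
      rw [measureReal_def, Measure.map_apply_of_aemeasurable hqm measurableSet_Ici]; rfl
    rw [← h1, ← h2, hq, map_qf]
  have hnull : NullMeasurableSet {u | x ≤ q u} unif :=
    hqm.nullMeasurableSet_preimage measurableSet_Ici
  have hlow := ae_eq_Iic_of_isLower (A := {u | x ≤ q u}ᶜ) fun u hu v hv hu' hvu => by
    simp only [mem_compl_iff, mem_ofPred_eq, not_le] at hu ⊢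
    exact (qf_monotoneOn _ hv hu' hvu.le).trans_lt hu
  rw [probReal_compl_eq_one_sub₀ hnull] at hlow
  have hup : {u | x ≤ q u} =ᵐ[unif] Ioi (1 - unif.real {u | x ≤ q u}) := by
    have := hlow.compl
    rwa [compl_compl, compl_Iic] at this
  rw [hP, hγ.eq_integral h0 ⟨measureReal_nonneg, measureReal_le_one⟩,
    ← setIntegral_congr_set hup, ← integral_indicator₀ hnull]
  rfl

/-- Since `h 1` is the full integral of `γ`, the difference is minus the integral over the
complementary event. -/
theorem HasDistortionWeight.survival_sub (hγ : HasDistortionWeight h γ) (h0 : h 0 = 0)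
    (hγi : Integrable γ unif) (hY : AEMeasurable Y P) (x : ℝ) :
    h (P.real {ω | -x ≤ Y ω}) - h 1 =
      -∫ u, layer {z | z.1 < z.2} (-qf (P.map Y)) γ (x, u) ∂unif := by
  have hqm : AEMeasurable (qf (P.map Y)) unif := aemeasurable_qf _
  have hnull : NullMeasurableSet {u | -x ≤ qf (P.map Y) u} unif :=
    hqm.nullMeasurableSet_preimage measurableSet_Ici
  have h1 : h 1 = ∫ u, γ u ∂unif := by
    rw [hγ.eq_integral h0 (right_mem_Icc.2 zero_le_one), sub_self,
      Measure.restrict_restrict measurableSet_Ioi, inter_eq_right.2 Ioo_subset_Ioi_self]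
  have hi : Integrable (fun u => layer {z | z.1 ≤ z.2} (qf (P.map Y)) γ (-x, u)) unif :=
    hγi.indicator₀ hnull
  rw [hγ.survival h0 hY, h1, ← integral_sub hi hγi, ← integral_neg]
  refine integral_congr_ae (ae_of_all _ fun u => ?_)
  by_cases hu : -x ≤ qf (P.map Y) u
  · have h2 : ¬ x < -qf (P.map Y) u := by linarith
    simp [layer, hu, h2]
  · have h2 : x < -qf (P.map Y) u := by linarith
    simp [layer, hu, h2]

theorem integrableOn_Iio_zero_iff {f : ℝ → ℝ} :
    IntegrableOn f (Iio 0) ↔ IntegrableOn (fun x => f (-x)) (Ioi 0) := by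
  refine ⟨fun hf => ?_, fun hf => ?_⟩
  · have := IntegrableOn.comp_neg_Ioi (f := f) (c := 0) (by simpa using hf)
    simpa using this
  · have := IntegrableOn.comp_neg_Iio (f := fun x => f (-x)) (c := 0) (by simpa using hf)
    simpa using this

theorem integral_Iio_zero (f : ℝ → ℝ) : ∫ x in Iio (0 : ℝ), f x = ∫ x in Ioi (0 : ℝ), f (-x) := by
  rw [integral_comp_neg_Ioi, neg_zero, integral_Iic_eq_integral_Iio]

/-- The quantile representation of the signed Choquet integral. -/
theorem HasDistortionWeight.choquet_eq (hγ : HasDistortionWeight h γ) (h0 : h 0 = 0)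
    (hγi : Integrable γ unif) (hY : AEMeasurable Y P)
    (hint : Integrable (fun u => γ u * qf (P.map Y) u) unif) :
    ChoquetFinite h P Y ∧ signedChoquet h P Y = ∫ u, γ u * qf (P.map Y) u ∂unif := by
  set q := qf (P.map Y) with hq
  have hqm : AEMeasurable q unif := aemeasurable_qf _
  have habs : Integrable (fun u => γ u * |q u|) unif := by
    refine hint.norm.mono (hγi.1.mul hqm.norm.aestronglyMeasurable) (ae_of_all _ fun u => ?_)
    simp
  have hpos : Integrable (fun u => γ u * max (q u) 0) unif := by
    refine ((hint.add habs).const_mul (1 / 2)).congr (ae_of_all _ fun u => ?_)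
    simp only [Pi.add_apply]
    rcases le_total (q u) 0 with h | h
    · rw [max_eq_right h, abs_of_nonpos h]; ring
    · rw [max_eq_left h, abs_of_nonneg h]; ring
  have hneg : Integrable (fun u => γ u * max (-q u) 0) unif := by
    refine (hpos.sub hint).congr (ae_of_all _ fun u => ?_)
    simp only [Pi.sub_apply]
    rcases le_total (q u) 0 with h | h
    · rw [max_eq_right h, max_eq_left (neg_nonneg.2 h)]; ring
    · rw [max_eq_left h, max_eq_right (neg_nonpos.2 h)]; ring
  obtain ⟨hp1, hp2⟩ := isOrderRel_le.integrable_integral_layer hγi.1 hqm hpos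
  obtain ⟨hn1, hn2⟩ := isOrderRel_lt.integrable_integral_layer (Q := -q) hγi.1 hqm.neg hneg
  simp only [Pi.neg_apply] at hn2
  have e1 : (fun x : ℝ => h (P.real {ω | x ≤ Y ω})) =
      fun x => ∫ u, layer {z | z.1 ≤ z.2} q γ (x, u) ∂unif := funext fun x => hγ.survival h0 hY x
  have e2 : (fun x : ℝ => h (P.real {ω | -x ≤ Y ω}) - h 1) =
      fun x => -∫ u, layer {z | z.1 < z.2} (-q) γ (x, u) ∂unif :=
    funext fun x => hγ.survival_sub h0 hγi hY x
  refine ⟨⟨?_, ?_⟩, ?_⟩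
  · rw [integrableOn_Iio_zero_iff, e2]
    exact hn1.neg
  · rw [e1]; exact hp1
  · rw [signedChoquet, integral_Iio_zero, e1, e2, integral_neg, hp2, hn2, neg_add_eq_sub,
      ← integral_sub hpos hneg]
    refine integral_congr_ae (ae_of_all _ fun u => ?_)
    dsimp only
    rcases le_total (q u) 0 with h | h
    · rw [max_eq_right h, max_eq_left (neg_nonneg.2 h)]; ring
    · rw [max_eq_left h, max_eq_right (neg_nonpos.2 h)]; ring

theorem integral_norm_le_of_sign {ρ : Measure ℝ} {f : ℝ → ℝ}
    (hf : (∀ᵐ u ∂ρ, 0 ≤ f u) ∨ ∀ᵐ u ∂ρ, f u ≤ 0) : ∫ u, ‖f u‖ ∂ρ ≤ ‖∫ u, f u ∂ρ‖ := by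
  rcases hf with hf | hf
  · rw [integral_congr_ae (hf.mono fun u hu => Real.norm_of_nonneg hu)]
    exact Real.le_norm_self _
  · rw [integral_congr_ae (hf.mono fun u hu => Real.norm_of_nonpos hu), integral_neg]
    exact (neg_le_abs _)

theorem IsOrderRel.layer_sign {s : Set (ℝ × ℝ)} (hs : IsOrderRel s) {Q : ℝ → ℝ} {S : Set ℝ} {x₀ x : ℝ}
    (hsign : (∀ u ∈ S, 0 ≤ γ u) ∨ ∀ u ∈ S, γ u ≤ 0)
    (hS : ∀ u ∈ Ioo (0 : ℝ) 1, x₀ < Q u → u ∈ S) (hx : x₀ < x) :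
    ∫ u, ‖layer s Q γ (x, u)‖ ∂unif ≤ ‖∫ u, layer s Q γ (x, u) ∂unif‖ := by
  classical
  have hI : ∀ᵐ u ∂unif, u ∈ Ioo (0 : ℝ) 1 := ae_restrict_mem measurableSet_Ioo
  refine integral_norm_le_of_sign (hsign.imp (fun hg => ?_) fun hg => ?_)
  · filter_upwards [hI] with u hu
    rw [layer, indicator_apply]
    split_ifs with hmem
    · exact hg u (hS u hu (hx.trans_le (hs.le_of_mem _ _ hmem)))
    · exact le_rfl
  · filter_upwards [hI] with u hu
    rw [layer, indicator_apply]
    split_ifs with hmem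
    · exact hg u (hS u hu (hx.trans_le (hs.le_of_mem _ _ hmem)))
    · exact le_rfl

/-- A monotone `γ` has constant sign near `0` and near `1`. High levels of `q` involve only `u` near
`1` and low levels only `u` near `0`, so far out the layers do not cancel and convergence of the
Choquet integrals is absolute. -/
theorem HasDistortionWeight.integrable_mul_qf (hγ : HasDistortionWeight h γ) (h0 : h 0 = 0)
    (hγi : Integrable γ unif) (hmono : MonotoneOn γ (Ioo 0 1)) (hY : AEMeasurable Y P)
    (hfin : ChoquetFinite h P Y) : Integrable (fun u => γ u * qf (P.map Y) u) unif := by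
  set q := qf (P.map Y) with hq
  have hqm : AEMeasurable q unif := aemeasurable_qf _
  have hq_mono : MonotoneOn q (Ioo 0 1) := qf_monotoneOn _
  have e1 : (fun x : ℝ => h (P.real {ω | x ≤ Y ω})) =
      fun x => ∫ u, layer {z | z.1 ≤ z.2} q γ (x, u) ∂unif := funext fun x => hγ.survival h0 hY x
  have e2 : (fun x : ℝ => h (P.real {ω | -x ≤ Y ω}) - h 1) =
      fun x => -∫ u, layer {z | z.1 < z.2} (-q) γ (x, u) ∂unif :=
    funext fun x => hγ.survival_sub h0 hγi hY x
  have hhalf : (1 / 2 : ℝ) ∈ Ioo (0 : ℝ) 1 := by norm_num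
  have hpos : Integrable (fun u => γ u * max (q u) 0) unif := by
    obtain ⟨a, ha, hsign⟩ : ∃ a ∈ Ioo (0 : ℝ) 1,
        (∀ u ∈ Ioo a 1, 0 ≤ γ u) ∨ ∀ u ∈ Ioo a 1, γ u ≤ 0 := by
      by_cases hex : ∃ a ∈ Ioo (0 : ℝ) 1, 0 ≤ γ a
      · obtain ⟨a, ha, hγa⟩ := hex
        exact ⟨a, ha, Or.inl fun u hu => hγa.trans (hmono ha ⟨ha.1.trans hu.1, hu.2⟩ hu.1.le)⟩
      -- Here `γ` is negative throughout, and `1 / 2` is an arbitrary threshold.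
      · push Not at hex
        exact ⟨1 / 2, hhalf, Or.inr fun u hu => (hex u ⟨hhalf.1.trans hu.1, hu.2⟩).le⟩
    refine isOrderRel_le.integrable_of_integral_layer hγi hqm (x₀ := q a) (fun x hx => ?_)
      (by rw [← e1]; exact hfin.2)
    refine isOrderRel_le.layer_sign hsign (fun u hu hqu => ⟨?_, hu.2⟩) hx
    by_contra hua
    exact absurd (hq_mono hu ha (not_lt.1 hua)) (not_le.2 hqu)
  have hneg : Integrable (fun u => γ u * max (-q u) 0) unif := by
    obtain ⟨a, ha, hsign⟩ : ∃ a ∈ Ioo (0 : ℝ) 1,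
        (∀ u ∈ Ioo 0 a, 0 ≤ γ u) ∨ ∀ u ∈ Ioo 0 a, γ u ≤ 0 := by
      by_cases hex : ∃ a ∈ Ioo (0 : ℝ) 1, γ a ≤ 0
      · obtain ⟨a, ha, hγa⟩ := hex
        exact ⟨a, ha, Or.inr fun u hu => (hmono ⟨hu.1, hu.2.trans ha.2⟩ ha hu.2.le).trans hγa⟩
      · push Not at hex
        exact ⟨1 / 2, hhalf, Or.inl fun u hu => (hex u ⟨hu.1, hu.2.trans hhalf.2⟩).le⟩
    refine isOrderRel_lt.integrable_of_integral_layer (Q := -q) hγi hqm.neg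
      (x₀ := -q a) (fun x hx => ?_) ?_
    · refine isOrderRel_lt.layer_sign hsign (fun u hu hqu => ⟨hu.1, ?_⟩) hx
      by_contra hua
      exact absurd (neg_le_neg (hq_mono ha hu (not_lt.1 hua))) (not_le.2 hqu)
    · have := integrableOn_Iio_zero_iff.1 hfin.1
      rw [e2] at this
      exact this.neg.congr (ae_of_all _ fun x => neg_neg _)
  refine (hpos.sub hneg).congr (ae_of_all _ fun u => ?_)
  simp only [Pi.sub_apply]
  rcases le_total (q u) 0 with h | h
  · rw [max_eq_right h, max_eq_left (neg_nonneg.2 h)]; ring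
  · rw [max_eq_left h, max_eq_right (neg_nonpos.2 h)]; ring

end Choquet

/-! ### Projections onto convex sets in a Hilbert space -/

section HilbertProjection

variable {H : Type*} [NormedAddCommGroup H] [InnerProductSpace ℝ H]

/-- `p` is the projection of `l` onto the convex set `C`, by the variational inequality. -/
def IsProjOn (C : Set H) (l p : H) : Prop := p ∈ C ∧ ∀ k ∈ C, inner ℝ (l - p) (k - p) ≤ 0

theorem isProjOn_iff {C : Set H} (hC : Convex ℝ C) {l p : H} :
    IsProjOn C l p ↔ p ∈ C ∧ ∀ k ∈ C, ‖p - l‖ ≤ ‖k - l‖ := by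
  refine and_congr_right fun hp => ?_
  rw [← norm_eq_iInf_iff_real_inner_le_zero hC hp]
  have hbdd : BddBelow (range fun w : C => ‖l - w‖) := ⟨0, by rintro _ ⟨w, rfl⟩; positivity⟩
  have : Nonempty C := ⟨⟨p, hp⟩⟩
  refine ⟨fun h k hk => ?_, fun h => le_antisymm (le_ciInf fun w => ?_) (ciInf_le hbdd ⟨p, hp⟩)⟩
  · rw [norm_sub_rev, h, norm_sub_rev k]
    exact ciInf_le hbdd ⟨k, hk⟩
  · rw [norm_sub_rev, norm_sub_rev l]
    exact h w w.2

theorem exists_isProjOn [CompleteSpace H] {C : Set H} (hne : C.Nonempty) (hcl : IsClosed C)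
    (hC : Convex ℝ C) (l : H) : ∃ p, IsProjOn C l p := by
  obtain ⟨p, hp, h⟩ := exists_norm_eq_iInf_of_complete_convex hne hcl.isComplete hC l
  exact ⟨p, hp, (norm_eq_iInf_iff_real_inner_le_zero hC hp).1 h⟩

/-- Adding the two variational inequalities, each tested at the other projection, gives `‖p - p'‖² ≤
⟪l - l', p - p'⟫`. -/
theorem IsProjOn.norm_sub_le {C : Set H} {l l' p p' : H} (h : IsProjOn C l p)
    (h' : IsProjOn C l' p') : ‖p - p'‖ ≤ ‖l - l'‖ := by
  have h1 := h.2 p' h'.1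
  have h2 := h'.2 p h.1
  have h3 : ‖p - p'‖ ^ 2 ≤ inner ℝ (l - l') (p - p') := by
    rw [← real_inner_self_eq_norm_sq]
    have e1 : inner ℝ (l - p) (p' - p) = -inner ℝ (l - p) (p - p') := by
      rw [← inner_neg_right, neg_sub]
    have e2 : inner ℝ (l - l') (p - p') - inner ℝ (p - p') (p - p') =
        inner ℝ (l - p) (p - p') - inner ℝ (l' - p') (p - p') := by
      rw [← inner_sub_left, ← inner_sub_left]
      congr 1
      abel
    linarith
  have h4 := h3.trans (real_inner_le_norm _ _)
  rcases (norm_nonneg (p - p')).eq_or_lt with h0 | h0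
  · rw [← h0]; positivity
  · nlinarith

theorem IsProjOn.inner_eq_zero {C : Set H} {l p e : H} (he : ∀ c ∈ C, ∀ t : ℝ, c + t • e ∈ C)
    (h : IsProjOn C l p) : inner ℝ (l - p) e = 0 := by
  have h1 := h.2 _ (he p h.1 1)
  have h2 := h.2 _ (he p h.1 (-1))
  simp only [add_sub_cancel_left, inner_smul_right] at h1 h2
  linarith

/-- A projection along the ray `q + s γ` maximizes `⟪γ, ·⟫` over the part of `C` that is no
further from `q`. -/
theorem IsProjOn.inner_le {C : Set H} {q γ p j : H} {s : ℝ} (hs : 0 < s)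
    (h : IsProjOn C (q + s • γ) p) (hj : j ∈ C) (hle : ‖j - q‖ ≤ ‖p - q‖) :
    inner ℝ γ j ≤ inner ℝ γ p := by
  have h1 := h.2 j hj
  -- The variational inequality becomes `s ⟪γ, j - p⟫ ≤ ⟪p - q, j - q⟫ - ‖p - q‖²`, and
  -- Cauchy-Schwarz makes the right side non-positive.
  have e1 : inner ℝ (q + s • γ - p) (j - p) =
      s * (inner ℝ γ j - inner ℝ γ p) - (inner ℝ (p - q) (j - q) - ‖p - q‖ ^ 2) := by
    rw [← inner_sub_right, ← real_inner_smul_left, ← real_inner_self_eq_norm_sq, ← inner_sub_right,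
      sub_sub_sub_cancel_right, ← inner_sub_left]
    congr 1
    abel
  have h2 := real_inner_le_norm (p - q) (j - q)
  have h3 : ‖p - q‖ * ‖j - q‖ ≤ ‖p - q‖ ^ 2 := by
    rw [sq]; exact mul_le_mul_of_nonneg_left hle (norm_nonneg _)
  have h4 : s * (inner ℝ γ j - inner ℝ γ p) ≤ 0 := by linarith
  nlinarith

/-- Existence is the intermediate value theorem: `p` is Lipschitz in `s`, starts at `q`, and moves
off because translation invariance along `e` gives `⟪p s - q, e⟫ = s ⟪γ, e⟫`. For uniqueness, two
projections at the same distance maximize `⟪γ, ·⟫` against each other; the variational inequality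
then forces them to coincide, and the component along `e` recovers `s`. In the application `e` is
the constant `1`, so `⟪γ, e⟫ = ∫ γ`. -/
theorem exists_unique_projection_radius {C : Set H} {q γ e : H} (hq : q ∈ C)
    (he : ∀ c ∈ C, ∀ t : ℝ, c + t • e ∈ C) (hγe : 0 < inner ℝ γ e) {p : ℝ → H}
    (hp : ∀ s, IsProjOn C (q + s • γ) (p s)) {r : ℝ} (hr : 0 < r) :
    ∃ s, 0 < s ∧ ∀ t, (0 < t ∧ ‖q - p t‖ ^ 2 = r) ↔ t = s := by
  have hcont : Continuous p := by
    refine (LipschitzWith.of_dist_le_mul (K := ‖γ‖₊) fun s t => ?_).continuous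
    rw [dist_eq_norm, dist_eq_norm]
    refine ((hp s).norm_sub_le (hp t)).trans_eq ?_
    rw [add_sub_add_left_eq_sub, ← sub_smul, norm_smul, mul_comm]; rfl
  have hmean : ∀ s, inner ℝ (p s - q) e = s * inner ℝ γ e := fun s => by
    have := (hp s).inner_eq_zero he
    rw [add_sub_right_comm, inner_add_left, real_inner_smul_left, ← neg_sub (p s) q,
      inner_neg_left] at this
    linarith
  have h0 : p 0 = q := by
    have := (hp 0).2 q hq
    rw [zero_smul, add_zero, real_inner_self_eq_norm_sq] at this
    have h1 : ‖q - p 0‖ = 0 := by nlinarith [norm_nonneg (q - p 0)]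
    exact (sub_eq_zero.1 (norm_eq_zero.1 h1)).symm
  have hepos : 0 < ‖e‖ := norm_pos_iff.2 fun h => by simp [h] at hγe
  obtain ⟨S, hS0, hS⟩ : ∃ S, 0 ≤ S ∧ r ≤ ‖q - p S‖ ^ 2 := by
    -- Chosen so that `⟪p S - q, e⟫ = √r ‖e‖`, whence `‖p S - q‖ ≥ √r` by Cauchy-Schwarz.
    refine ⟨√r * ‖e‖ / inner ℝ γ e, by positivity, ?_⟩
    set S := √r * ‖e‖ / inner ℝ γ e with hSdef
    have h1 := (hmean S).symm.trans_le (real_inner_le_norm _ _)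
    rw [hSdef, div_mul_cancel₀ _ hγe.ne', ← hSdef] at h1
    have h2 : √r ≤ ‖q - p S‖ := by
      rw [norm_sub_rev]; exact le_of_mul_le_mul_right h1 hepos
    exact (Real.sqrt_le_left (norm_nonneg _)).1 h2
  obtain ⟨s, hs, hsr⟩ := intermediate_value_Icc hS0
    (f := fun t => ‖q - p t‖ ^ 2) (by fun_prop)
    (show r ∈ Icc _ _ from ⟨by simpa [h0] using hr.le, hS⟩)
  have hs0 : 0 < s := by
    refine hs.1.lt_of_ne fun h => ?_
    rw [← h] at hsr
    simp [h0] at hsr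
    exact hr.ne hsr
  refine ⟨s, hs0, fun t => ⟨fun ⟨ht0, htr⟩ => ?_, fun h => h ▸ ⟨hs0, hsr⟩⟩⟩
  have hnorm : ‖p t - q‖ = ‖p s - q‖ := by
    rw [norm_sub_rev, norm_sub_rev (p s)]
    exact (pow_left_inj₀ (norm_nonneg _) (norm_nonneg _) two_ne_zero).1 (htr.trans hsr.symm)
  have hin : inner ℝ γ (p t) = inner ℝ γ (p s) :=
    le_antisymm ((hp s).inner_le hs0 (hp t).1 hnorm.le) ((hp t).inner_le ht0 (hp s).1 hnorm.ge)
  have h1 := (hp s).2 (p t) (hp t).1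
  have e1 : inner ℝ (q + s • γ - p s) (p t - p s) =
      s * (inner ℝ γ (p t) - inner ℝ γ (p s)) - inner ℝ (p s - q) (p t - p s) := by
    rw [← inner_sub_right, ← real_inner_smul_left, ← inner_sub_left]
    congr 1
    abel
  rw [e1, hin, sub_self, mul_zero, zero_sub] at h1
  have e2 : ‖p t - q‖ ^ 2 = ‖p s - q‖ ^ 2 + 2 * inner ℝ (p s - q) (p t - p s) + ‖p t - p s‖ ^ 2 := by
    rw [← norm_add_sq_real]
    congr 2
    abel
  rw [hnorm] at e2
  have h2 : ‖p t - p s‖ = 0 := by nlinarith [norm_nonneg (p t - p s)]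
  have h3 : p t = p s := sub_eq_zero.1 (norm_eq_zero.1 h2)
  have h4 := hmean t
  rw [h3, hmean s] at h4
  exact (mul_right_cancel₀ hγe.ne' h4).symm

end HilbertProjection

/-! ### The isotonic cone in `L²(0,1)` -/

section IsotonicCone

/-- The isotonic cone as a set of classes of square integrable functions. -/
def isotonicConeLp : Set (Lp ℝ 2 unif) :=
  {f | ∃ S : Set ℝ, (∀ᵐ u ∂unif, u ∈ S) ∧ MonotoneOn f S}

theorem qf_mem_isotonicCone {μ : Measure ℝ} (h : MemLp (qf μ) 2 unif) : qf μ ∈ isotonicCone :=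
  ⟨qf_monotoneOn μ, fun _ hu => qf_leftContinuous μ hu, h⟩

theorem toLp_mem_isotonicConeLp {j : ℝ → ℝ} (hj : j ∈ isotonicCone) :
    hj.2.2.toLp j ∈ isotonicConeLp := by
  refine ⟨{u | hj.2.2.toLp j u = j u} ∩ Ioo 0 1, ?_, ?_⟩
  · filter_upwards [hj.2.2.coeFn_toLp, ae_restrict_mem measurableSet_Ioo] with u h1 h2 using ⟨h1, h2⟩
  · intro u hu v hv huv
    rw [hu.1, hv.1]
    exact hj.1 hu.2 hv.2 huv

/-- The quantile function of the law of `f` is a left-continuous monotone representative. -/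
theorem exists_isotonicCone_of_mem {f : Lp ℝ 2 unif} (hf : f ∈ isotonicConeLp) :
    ∃ j, ∃ hj : j ∈ isotonicCone, hj.2.2.toLp j = f := by
  obtain ⟨S, hS, hmono⟩ := hf
  have hm : AEMeasurable f unif := (Lp.aestronglyMeasurable f).aemeasurable
  have hae := qf_map_ae_eq hm hS hmono
  have hmem : MemLp (qf (unif.map f)) 2 unif := (memLp_congr_ae hae).2 (Lp.memLp f)
  refine ⟨qf (unif.map f), qf_mem_isotonicCone hmem, ?_⟩
  exact Lp.ext (hmem.coeFn_toLp.trans hae)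

theorem convex_isotonicConeLp : Convex ℝ isotonicConeLp := by
  rintro f ⟨S, hS, hf⟩ g ⟨T, hT, hg⟩ a b ha hb -
  refine ⟨{u | (a • f + b • g : Lp ℝ 2 unif) u = a * f u + b * g u} ∩ (S ∩ T), ?_, ?_⟩
  · filter_upwards [hS, hT, Lp.coeFn_add (a • f) (b • g), Lp.coeFn_smul a f, Lp.coeFn_smul b g]
      with u h1 h2 h3 h4 h5
    refine ⟨?_, h1, h2⟩
    rw [mem_ofPred_eq, h3, Pi.add_apply, h4, h5]; rfl
  · intro u hu v hv huv
    rw [hu.1, hv.1]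
    exact add_le_add (mul_le_mul_of_nonneg_left (hf hu.2.1 hv.2.1 huv) ha)
      (mul_le_mul_of_nonneg_left (hg hu.2.2 hv.2.2 huv) hb)

/-- A subsequence converges almost everywhere, and pointwise limits preserve order. -/
theorem isClosed_isotonicConeLp : IsClosed isotonicConeLp := by
  refine isSeqClosed_iff_isClosed.1 fun f g hf hlim => ?_
  obtain ⟨φ, -, hφ⟩ := (tendstoInMeasure_of_tendsto_Lp hlim).exists_seq_tendsto_ae
  choose S hS hmono using hf
  refine ⟨{u | Tendsto (fun n => f (φ n) u) atTop (𝓝 (g u))} ∩ ⋂ n, S n, ?_, ?_⟩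
  · filter_upwards [hφ, ae_all_iff.2 hS] with u h1 h2 using ⟨h1, mem_iInter.2 h2⟩
  · intro u hu v hv huv
    exact le_of_tendsto_of_tendsto' hu.1 hv.1 fun n =>
      hmono (φ n) (mem_iInter.1 hu.2 _) (mem_iInter.1 hv.2 _) huv

theorem add_const_mem_isotonicConeLp {f : Lp ℝ 2 unif} (hf : f ∈ isotonicConeLp) (t : ℝ) :
    f + t • (memLp_const (1 : ℝ)).toLp (fun _ : ℝ => (1 : ℝ)) ∈ isotonicConeLp := by
  obtain ⟨S, hS, hmono⟩ := hf
  set e : Lp ℝ 2 unif := (memLp_const (1 : ℝ)).toLp (fun _ : ℝ => (1 : ℝ)) with he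
  refine ⟨{u | (f + t • e : Lp ℝ 2 unif) u = f u + t} ∩ S, ?_, ?_⟩
  · filter_upwards [hS, Lp.coeFn_add f (t • e), Lp.coeFn_smul t e,
      (memLp_const (μ := unif) (p := 2) (1 : ℝ)).coeFn_toLp] with u h1 h2 h3 h4
    refine ⟨?_, h1⟩
    rw [mem_ofPred_eq, h2, Pi.add_apply, h3, Pi.smul_apply, he, h4, smul_eq_mul, mul_one]
  · intro u hu v hv huv
    rw [hu.1, hv.1]
    exact add_le_add_left (hmono hu.2 hv.2 huv) t

theorem inner_toLp {f g : ℝ → ℝ} (hf : MemLp f 2 unif) (hg : MemLp g 2 unif) :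
    inner ℝ (hf.toLp f) (hg.toLp g) = ∫ u, f u * g u ∂unif := by
  rw [L2.inner_def]
  refine integral_congr_ae ?_
  filter_upwards [hf.coeFn_toLp, hg.coeFn_toLp] with u h1 h2
  rw [h1, h2]
  exact mul_comm _ _

theorem norm_toLp_sub_sq {f g : ℝ → ℝ} (hf : MemLp f 2 unif) (hg : MemLp g 2 unif) :
    ‖hf.toLp f - hg.toLp g‖ ^ 2 = ∫ u, (f u - g u) ^ 2 ∂unif := by
  rw [← MemLp.toLp_sub, ← real_inner_self_eq_norm_sq, inner_toLp]
  simp_rw [sq]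
  rfl

theorem isIsotonicProj_iff {l j : ℝ → ℝ} (hl : MemLp l 2 unif) (hj : j ∈ isotonicCone) :
    IsIsotonicProj l j ↔ IsProjOn isotonicConeLp (hl.toLp l) (hj.2.2.toLp j) := by
  rw [isProjOn_iff convex_isotonicConeLp, IsIsotonicProj]
  refine and_congr (iff_of_true hj (toLp_mem_isotonicConeLp hj)) ⟨fun h k hk => ?_, fun h k hk => ?_⟩
  · obtain ⟨k, hk', rfl⟩ := exists_isotonicCone_of_mem hk
    rw [← pow_le_pow_iff_left₀ (norm_nonneg _) (norm_nonneg _) two_ne_zero, norm_toLp_sub_sq,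
      norm_toLp_sub_sq]
    exact h k hk'
  · have := h _ (toLp_mem_isotonicConeLp hk)
    rwa [← pow_le_pow_iff_left₀ (norm_nonneg _) (norm_nonneg _) two_ne_zero, norm_toLp_sub_sq,
      norm_toLp_sub_sq] at this

/-- `isotonicProj` is an arbitrary choice until a minimizer exists; projection onto a closed convex
set in `L²` provides one, with a representative in the cone. -/
theorem isIsotonicProj_isotonicProj {l : ℝ → ℝ} (hl : MemLp l 2 unif) :
    IsIsotonicProj l (isotonicProj l) := by
  have hne : isotonicConeLp.Nonempty := ⟨0, {u | (0 : Lp ℝ 2 unif) u = 0}, by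
    filter_upwards [Lp.coeFn_zero ℝ 2 unif] with u hu using hu, fun u hu v hv _ => by
    rw [show (0 : Lp ℝ 2 unif) u = 0 from hu, show (0 : Lp ℝ 2 unif) v = 0 from hv]⟩
  obtain ⟨p, hp⟩ := exists_isProjOn hne isClosed_isotonicConeLp convex_isotonicConeLp (hl.toLp l)
  obtain ⟨j, hj, rfl⟩ := exists_isotonicCone_of_mem hp.1
  exact Classical.epsilon_spec (p := IsIsotonicProj l) ⟨j, (isIsotonicProj_iff hl hj).2 hp⟩

end IsotonicCone

/-! ### Projections of `q + sγ` onto the isotonic cone -/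

section Multiplier

variable {q γ : ℝ → ℝ}

theorem memLp_perturb (hq : MemLp q 2 unif) (hγ : MemLp γ 2 unif) (s : ℝ) :
    MemLp (fun u => q u + s * γ u) 2 unif := hq.add (hγ.const_mul s)

theorem isProjOn_perturb (hq : MemLp q 2 unif) (hγ : MemLp γ 2 unif) (s : ℝ) :
    IsProjOn isotonicConeLp (hq.toLp q + s • hγ.toLp γ)
      ((isIsotonicProj_isotonicProj (memLp_perturb hq hγ s)).1.2.2.toLp _) := by
  have h := isIsotonicProj_isotonicProj (memLp_perturb hq hγ s)
  exact (isIsotonicProj_iff (memLp_perturb hq hγ s) h.1).1 h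

theorem integral_mul_le_isotonicProj (hq : MemLp q 2 unif) (hγ : MemLp γ 2 unif) {s : ℝ}
    (hs : 0 < s) {j : ℝ → ℝ} (hj : j ∈ isotonicCone)
    (hle : ∫ u, (j u - q u) ^ 2 ∂unif ≤
      ∫ u, (q u - isotonicProj (fun u => q u + s * γ u) u) ^ 2 ∂unif) :
    ∫ u, γ u * j u ∂unif ≤ ∫ u, γ u * isotonicProj (fun u => q u + s * γ u) u ∂unif := by
  have h := isIsotonicProj_isotonicProj (memLp_perturb hq hγ s)
  rw [← inner_toLp hγ hj.2.2, ← inner_toLp hγ h.1.2.2]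
  refine (isProjOn_perturb hq hγ s).inner_le hs (toLp_mem_isotonicConeLp hj) ?_
  rw [← pow_le_pow_iff_left₀ (norm_nonneg _) (norm_nonneg _) two_ne_zero, norm_toLp_sub_sq,
    norm_sub_rev, norm_toLp_sub_sq]
  exact hle

theorem exists_unique_isotonic_radius (hq : q ∈ isotonicCone) (hγ : MemLp γ 2 unif)
    (hpos : 0 < ∫ u, γ u ∂unif) {r : ℝ} (hr : 0 < r) :
    ∃ s, 0 < s ∧ ∀ t, (0 < t ∧
      ∫ u, (q u - isotonicProj (fun u => q u + t * γ u) u) ^ 2 ∂unif = r) ↔ t = s := by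
  have hγe : 0 < inner ℝ (hγ.toLp γ) ((memLp_const (1 : ℝ)).toLp (fun _ : ℝ => (1 : ℝ))) := by
    rw [inner_toLp]; simpa using hpos
  have := exists_unique_projection_radius (toLp_mem_isotonicConeLp hq)
    (fun c hc t => add_const_mem_isotonicConeLp hc t) hγe (isProjOn_perturb hq.2.2 hγ) hr
  simpa only [norm_toLp_sub_sq] using this

end Multiplier

/-! ### The squared Mahalanobis distance -/

section QuadForm

variable {n : ℕ}

theorem quadForm_diagonal (d : Fin n → ℝ) (x : EuclideanSpace ℝ (Fin n)) :
    quadForm (Matrix.diagonal d) x = ∑ i, d i * x i ^ 2 := by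
  simp only [quadForm, dotProduct, Matrix.mulVec_diagonal]
  exact Finset.sum_congr rfl fun i _ => by ring

theorem bregmanDiv_quadForm_diagonal (d : Fin n → ℝ) (x y : EuclideanSpace ℝ (Fin n)) :
    bregmanDiv (quadForm (Matrix.diagonal d)) x y = ∑ i, d i * (x i - y i) ^ 2 := by
  have hfun : quadForm (Matrix.diagonal d) = fun x => ∑ i, d i * x i ^ 2 :=
    funext (quadForm_diagonal d)
  have hder : HasFDerivAt (fun x : EuclideanSpace ℝ (Fin n) => ∑ i, d i * x i ^ 2)
      (∑ i, d i • ((2 * y i) • (EuclideanSpace.proj i : EuclideanSpace ℝ (Fin n) →L[ℝ] ℝ))) y := by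
    refine HasFDerivAt.fun_sum fun i _ => ?_
    have h1 := (EuclideanSpace.proj i : EuclideanSpace ℝ (Fin n) →L[ℝ] ℝ).hasFDerivAt (x := y)
    simpa using (h1.pow 2).const_mul (d i)
  rw [bregmanDiv, hfun, hder.fderiv]
  have hproj : ∀ i, (EuclideanSpace.proj i : EuclideanSpace ℝ (Fin n) →L[ℝ] ℝ) (x - y) =
      x i - y i := fun i => rfl
  simp only [sum_apply, smul_apply, smul_eq_mul, hproj]
  rw [← Finset.sum_sub_distrib, ← Finset.sum_sub_distrib]
  exact Finset.sum_congr rfl fun i _ => by ring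

end QuadForm

/-! ### The uncertainty set against `L²` balls of quantile functions -/

section Ball

variable {Ω : Type*} [MeasurableSpace Ω] {P : Measure Ω} [IsProbabilityMeasure P]

/-- Random vectors in the uncertainty set have aggregate quantile functions close to that of the
reference vector. -/
theorem lintegral_qf_sub_sq_le_of_mem_bwBall {n : ℕ} {g : EuclideanSpace ℝ (Fin n) → ℝ} {K : ℝ≥0}
    (hg : LipschitzWith K g) {d : Fin n → ℝ} {qmin : ℝ} (hqmin : 0 < qmin) (hd : ∀ i, qmin ≤ d i)
    {ε : ℝ} {X Y : Ω → EuclideanSpace ℝ (Fin n)} (hX : AEMeasurable X P)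
    (hY : Y ∈ bwBall (quadForm (Matrix.diagonal d)) P ε X) :
    ∫⁻ u, ENNReal.ofReal ((qf (P.map fun ω => g (Y ω)) u - qf (P.map fun ω => g (X ω)) u) ^ 2) ∂unif ≤
      ENNReal.ofReal ((K : ℝ) ^ 2 * ε / qmin) := by
  obtain ⟨hYm, hball⟩ := hY
  have hgm : Measurable g := hg.continuous.measurable
  set W := ∫⁻ u, ENNReal.ofReal
    ((qf (P.map fun ω => g (Y ω)) u - qf (P.map fun ω => g (X ω)) u) ^ 2) ∂unif with hW
  have hprobX := Measure.isProbabilityMeasure_map hX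
  have hprobY := Measure.isProbabilityMeasure_map hYm
  set c : ℝ≥0∞ := ENNReal.ofReal ((K : ℝ) ^ 2 / qmin) with hc
  have hπ : ∀ π ∈ couplings (P.map Y) (P.map X), W ≤ c * ∫⁻ z,
      ENNReal.ofReal (bregmanDiv (quadForm (Matrix.diagonal d)) z.1 z.2) ∂π := fun π hπ => by
    have hprob : IsProbabilityMeasure π := by
      rw [← Measure.isProbabilityMeasure_map_iff (μ := π) measurable_fst.aemeasurable, hπ.1]
      exact hprobY
    have e1 : (P.map fun ω => g (Y ω)) = π.map fun z => g z.1 := by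
      rw [show (fun ω => g (Y ω)) = g ∘ Y from rfl,
        ← AEMeasurable.map_map_of_aemeasurable hgm.aemeasurable hYm, ← hπ.1,
        Measure.map_map hgm measurable_fst]
      rfl
    have e2 : (P.map fun ω => g (X ω)) = π.map fun z => g z.2 := by
      rw [show (fun ω => g (X ω)) = g ∘ X from rfl,
        ← AEMeasurable.map_map_of_aemeasurable hgm.aemeasurable hX, ← hπ.2,
        Measure.map_map hgm measurable_snd]
      rfl
    rw [hW, e1, e2, ← lintegral_const_mul' _ _ ENNReal.ofReal_ne_top]
    refine (lintegral_qf_sub_sq_le π (hgm.comp measurable_fst) (hgm.comp measurable_snd)).trans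
      (lintegral_mono fun z => ?_)
    rw [← ENNReal.ofReal_mul (by positivity)]
    refine ENNReal.ofReal_le_ofReal ?_
    rw [bregmanDiv_quadForm_diagonal]
    have h1 : (g z.1 - g z.2) ^ 2 ≤ (K * ‖z.1 - z.2‖) ^ 2 := by
      rw [sq_le_sq, abs_of_nonneg (show 0 ≤ (K : ℝ) * ‖z.1 - z.2‖ by positivity)]
      have := hg.dist_le_mul z.1 z.2
      rwa [Real.dist_eq, dist_eq_norm] at this
    have h2 : qmin * ‖z.1 - z.2‖ ^ 2 ≤ ∑ i, d i * (z.1 i - z.2 i) ^ 2 := by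
      rw [EuclideanSpace.real_norm_sq_eq, Finset.mul_sum]
      exact Finset.sum_le_sum fun i _ => mul_le_mul_of_nonneg_right (hd i) (sq_nonneg _)
    refine h1.trans ?_
    rw [mul_pow, div_mul_eq_mul_div, le_div_iff₀ hqmin, mul_assoc]
    exact mul_le_mul_of_nonneg_left (by linarith) (by positivity)
  have hprod : (P.map Y).prod (P.map X) ∈ couplings (P.map Y) (P.map X) := by
    constructor
    · rw [Measure.map_fst_prod, measure_univ, one_smul]
    · rw [Measure.map_snd_prod, measure_univ, one_smul]
  have hWc : W ≤ c * bwDiv (quadForm (Matrix.diagonal d)) (P.map Y) (P.map X) := by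
    -- When `K = 0` the constant cannot be divided out of the infimum, but one coupling, the
    -- product, already gives `W = 0`.
    by_cases hc0 : c = 0
    · have := hπ _ hprod
      rw [hc0, zero_mul] at this ⊢
      exact this
    · rw [mul_comm, ← ENNReal.div_le_iff hc0 ENNReal.ofReal_ne_top]
      refine le_iInf₂ fun π h => ?_
      rw [ENNReal.div_le_iff hc0 ENNReal.ofReal_ne_top, mul_comm]
      exact hπ π h
  refine hWc.trans ((mul_le_mul_right hball c).trans_eq ?_)
  rw [hc, ← ENNReal.ofReal_mul (by positivity), div_mul_eq_mul_div]

/-- A coupling of a random element with a uniform variable that reproduces a given statistic as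
a quantile transform. -/
theorem exists_quantile_coupling {E : Type*} [MeasurableSpace E] [StandardBorelSpace E] [Nonempty E]
    {X : Ω → E} (hX : AEMeasurable X P) {g : E → ℝ} (hg : Measurable g) :
    ∃ ρ : Measure (ℝ × E), IsProbabilityMeasure ρ ∧ ρ.map Prod.fst = unif ∧
      ρ.map Prod.snd = P.map X ∧ ∀ᵐ z ∂ρ, g z.2 = qf (P.map fun ω => g (X ω)) z.1 := by
  have hgX : AEMeasurable (fun ω => g (X ω)) P := hg.comp_aemeasurable hX
  have := Measure.isProbabilityMeasure_map hgX
  set ν := P.map fun ω => g (X ω) with hν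
  have hqm := aemeasurable_qf ν
  -- A Borel version is needed to pull a kernel back along the quantile function.
  set q' := hqm.mk (qf ν) with hq'
  have hq'm : Measurable q' := hqm.measurable_mk
  have hmap : unif.map q' = ν := by rw [← Measure.map_congr hqm.ae_eq_mk, map_qf]
  set κ := condDistrib X (fun ω => g (X ω)) P with hκ
  -- Draw `u` uniformly, then `X` from its conditional law given `g(X) = q' u`.
  set ρ := unif ⊗ₘ κ.comap q' hq'm with hρ
  have hT : Measurable fun z : ℝ × E => (q' z.1, z.2) := by fun_prop
  have hfst : ρ.map Prod.fst = unif := Measure.fst_compProd unif _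
  have hjoint : ρ.map (fun z => (q' z.1, z.2)) = P.map fun ω => (g (X ω), X ω) := by
    rw [← compProd_map_condDistrib hX, ← hν, ← hκ, ← hmap]
    refine Measure.ext fun s hs => ?_
    rw [Measure.map_apply hT hs, hρ, Measure.compProd_apply (hT hs), Measure.compProd_apply hs,
      lintegral_map (Kernel.measurable_kernel_prodMk_left hs) hq'm]
    rfl
  refine ⟨ρ, inferInstance, hfst, ?_, ?_⟩
  · have h1 := congrArg (fun m => m.map Prod.snd) hjoint
    rw [Measure.map_map measurable_snd hT,
      AEMeasurable.map_map_of_aemeasurable measurable_snd.aemeasurable (hgX.prodMk hX)] at h1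
    exact h1
  · have hs : MeasurableSet {w : ℝ × E | g w.2 = w.1} :=
      measurableSet_eq_fun (hg.comp measurable_snd) measurable_fst
    have h1 : ∀ᵐ w ∂(P.map fun ω => (g (X ω), X ω)), g w.2 = w.1 :=
      (ae_map_iff (hgX.prodMk hX) hs).2 (ae_of_all _ fun _ => rfl)
    rw [← hjoint, ae_map_iff hT.aemeasurable hs] at h1
    have h2 : ∀ᵐ z ∂ρ, qf ν z.1 = q' z.1 :=
      ae_of_ae_map measurable_fst.aemeasurable (by rw [hfst]; exact hqm.ae_eq_mk)
    filter_upwards [h1, h2] with z h3 h4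
    exact h3.trans h4.symm

/-- Every non-decreasing function close to the reference quantile function is the aggregate
quantile function of a member of the uncertainty set. -/
theorem exists_mem_bwBall_qf_eq (hP : NonAtomicMeasure P) {m k : ℕ}
    {g : EuclideanSpace ℝ (Fin (m + k)) → ℝ} (hg : Measurable g)
    {gt : EuclideanSpace ℝ (Fin m) → ℝ} {β : EuclideanSpace ℝ (Fin k)}
    (hdec : HasLinearPart g gt β) (hβ : β ≠ 0) {d : Fin (m + k) → ℝ} {qmax : ℝ} (hqmax : 0 < qmax)
    (hd : ∀ i, d i ≤ qmax) {ε : ℝ} {X : Ω → EuclideanSpace ℝ (Fin (m + k))} (hX : AEMeasurable X P)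
    {G : ℝ → ℝ} (hG : MonotoneOn G (Ioo 0 1))
    (hGL : MemLp (fun u => G u - qf (P.map fun ω => g (X ω)) u) 2 unif)
    (hGε : ∫ u, (G u - qf (P.map fun ω => g (X ω)) u) ^ 2 ∂unif ≤ ‖β‖ ^ 2 * ε / qmax) :
    ∃ Y ∈ bwBall (quadForm (Matrix.diagonal d)) P ε X,
      qf (P.map fun ω => g (Y ω)) =ᵐ[unif] G := by
  obtain ⟨ρ, hρ, hfst, hsnd, hae⟩ := exists_quantile_coupling hX hg
  set q := qf (P.map fun ω => g (X ω)) with hq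
  have hqm : AEMeasurable q unif := aemeasurable_qf _
  have hGm : AEMeasurable G unif := aemeasurable_restrict_of_monotoneOn measurableSet_Ioo hG
  set D := (hGm.sub hqm).mk (G - q) with hD
  have hDm : Measurable D := (hGm.sub hqm).measurable_mk
  have hDae : ∀ᵐ u ∂unif, G u - q u = D u := (hGm.sub hqm).ae_eq_mk
  have hβ2 : 0 < ‖β‖ ^ 2 := by positivity
  set b : EuclideanSpace ℝ (Fin (m + k)) :=
    WithLp.toLp 2 (Fin.append (fun _ : Fin m => (0 : ℝ)) fun j => β j) with hb
  -- The shift by `D β / ‖β‖²` in the linear coordinates raises `g` by exactly `D` and costs at most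
  -- `qmax D² / ‖β‖²`.
  set T : ℝ × EuclideanSpace ℝ (Fin (m + k)) → EuclideanSpace ℝ (Fin (m + k)) :=
    fun z => z.2 + (D z.1 / ‖β‖ ^ 2) • b with hTdef
  have hT : Measurable T := by fun_prop
  have hgT : ∀ z, g (T z) = g z.2 + D z.1 := fun z => by
    have hβs : ∑ j, β j ^ 2 = ‖β‖ ^ 2 := (EuclideanSpace.real_norm_sq_eq β).symm
    rw [hdec, hdec z.2]
    have h1 : (fun i => (T z) (Fin.castAdd k i)) = fun i => z.2 (Fin.castAdd k i) := by
      ext i; simp [hTdef, hb]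
    have h2 : ∀ j, β j * (T z) (Fin.natAdd m j) =
        β j * z.2 (Fin.natAdd m j) + D z.1 / ‖β‖ ^ 2 * β j ^ 2 := fun j => by
      simp [hTdef, hb]; ring
    rw [h1, Finset.sum_congr rfl fun j _ => h2 j, Finset.sum_add_distrib, ← Finset.mul_sum, hβs,
      div_mul_cancel₀ _ hβ2.ne', add_assoc]
  have hprobT := Measure.isProbabilityMeasure_map (μ := ρ) hT.aemeasurable
  obtain ⟨Y, hYm, hPY⟩ := exists_map_eq P hP (ρ.map T)
  refine ⟨Y, ⟨hYm, ?_⟩, ?_⟩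
  · have hπ : ρ.map (fun z => (T z, z.2)) ∈ couplings (P.map Y) (P.map X) := by
      constructor
      · rw [Measure.map_map measurable_fst (hT.prodMk measurable_snd), hPY]; rfl
      · rw [Measure.map_map measurable_snd (hT.prodMk measurable_snd), ← hsnd]; rfl
    refine (iInf₂_le _ hπ).trans ?_
    have hmeas : Measurable fun z : EuclideanSpace ℝ (Fin (m + k)) × EuclideanSpace ℝ (Fin (m + k)) =>
        ENNReal.ofReal (bregmanDiv (quadForm (Matrix.diagonal d)) z.1 z.2) := by
      simp_rw [bregmanDiv_quadForm_diagonal]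
      fun_prop
    rw [lintegral_map hmeas (hT.prodMk measurable_snd)]
    have hle : ∀ z, bregmanDiv (quadForm (Matrix.diagonal d)) (T z) z.2 ≤
        qmax / ‖β‖ ^ 2 * D z.1 ^ 2 := fun z => by
      have hbs : ∑ i, b i ^ 2 = ‖β‖ ^ 2 := by
        rw [EuclideanSpace.real_norm_sq_eq β, Fin.sum_univ_add]
        simp [hb]
      have h1 : ∀ i, (T z) i - z.2 i = D z.1 / ‖β‖ ^ 2 * b i := fun i => by simp [hTdef]
      rw [bregmanDiv_quadForm_diagonal]
      calc ∑ i, d i * ((T z) i - z.2 i) ^ 2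
          ≤ ∑ i, qmax * (D z.1 / ‖β‖ ^ 2) ^ 2 * b i ^ 2 := Finset.sum_le_sum fun i _ => by
            rw [h1, mul_pow, ← mul_assoc]
            gcongr
            exact hd i
        _ = qmax / ‖β‖ ^ 2 * D z.1 ^ 2 := by
            rw [← Finset.mul_sum, hbs]
            field_simp
    calc ∫⁻ z, ENNReal.ofReal (bregmanDiv (quadForm (Matrix.diagonal d)) (T z) z.2) ∂ρ
        ≤ ∫⁻ z, ENNReal.ofReal (qmax / ‖β‖ ^ 2 * D z.1 ^ 2) ∂ρ :=
          lintegral_mono fun z => ENNReal.ofReal_le_ofReal (hle z)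
      _ = ∫⁻ u, ENNReal.ofReal (qmax / ‖β‖ ^ 2 * D u ^ 2) ∂unif := by
          rw [← hfst, lintegral_map (by fun_prop) measurable_fst]
      _ = ∫⁻ u, ENNReal.ofReal (qmax / ‖β‖ ^ 2 * (G u - q u) ^ 2) ∂unif :=
          lintegral_congr_ae (hDae.mono fun u hu => by simp only [hu])
      _ = ENNReal.ofReal (∫ u, qmax / ‖β‖ ^ 2 * (G u - q u) ^ 2 ∂unif) :=
          (ofReal_integral_eq_lintegral_ofReal (hGL.integrable_sq.const_mul _)
            (ae_of_all _ fun u => by positivity)).symm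
      _ ≤ ENNReal.ofReal ε := by
          refine ENNReal.ofReal_le_ofReal ?_
          rw [integral_const_mul]
          calc qmax / ‖β‖ ^ 2 * ∫ u, (G u - q u) ^ 2 ∂unif
              ≤ qmax / ‖β‖ ^ 2 * (‖β‖ ^ 2 * ε / qmax) :=
                mul_le_mul_of_nonneg_left hGε (by positivity)
            _ = ε := by field_simp
  · have hlaw : (P.map fun ω => g (Y ω)) = unif.map G := by
      have h1 : (P.map fun ω => g (Y ω)) = (ρ.map T).map g := by
        rw [← hPY, AEMeasurable.map_map_of_aemeasurable hg.aemeasurable hYm]; rfl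
      have hGm' : AEMeasurable G (ρ.map Prod.fst) := hfst ▸ hGm
      have h2 : ρ.map (g ∘ T) = ρ.map (G ∘ Prod.fst) := by
        refine Measure.map_congr ?_
        have h3 : ∀ᵐ z ∂ρ, G z.1 - q z.1 = D z.1 :=
          ae_of_ae_map measurable_fst.aemeasurable (by rw [hfst]; exact hDae)
        filter_upwards [hae, h3] with z h4 h5
        rw [Function.comp_apply, hgT, h4, ← h5, Function.comp_apply]
        ring
      rw [h1, Measure.map_map hg hT, h2,
        ← AEMeasurable.map_map_of_aemeasurable hGm' measurable_fst.aemeasurable, hfst]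
    rw [hlaw]
    exact qf_map_ae_eq hGm (ae_restrict_mem measurableSet_Ioo) hG

end Ball

/-! ### Integral estimates and multipliers -/

theorem memLp_two_of_lintegral_le {f : ℝ → ℝ} (hf : AEMeasurable f unif) {r : ℝ} (hr : 0 ≤ r)
    (h : ∫⁻ u, ENNReal.ofReal (f u ^ 2) ∂unif ≤ ENNReal.ofReal r) :
    MemLp f 2 unif ∧ ∫ u, f u ^ 2 ∂unif ≤ r := by
  have hsm : AEStronglyMeasurable (fun u => f u ^ 2) unif := (hf.pow_const 2).aestronglyMeasurable
  have h0 : 0 ≤ᵐ[unif] fun u => f u ^ 2 := ae_of_all _ fun u => sq_nonneg _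
  have hint : Integrable (fun u => f u ^ 2) unif :=
    (lintegral_ofReal_ne_top_iff_integrable hsm h0).1 (h.trans_lt ENNReal.ofReal_lt_top).ne
  refine ⟨(memLp_two_iff_integrable_sq hf.aestronglyMeasurable).2 hint, ?_⟩
  rw [integral_eq_lintegral_of_nonneg_ae h0 hsm]
  exact (ENNReal.toReal_mono ENNReal.ofReal_ne_top h).trans_eq (ENNReal.toReal_ofReal hr)

theorem norm_toLp_eq_sqrt {f : ℝ → ℝ} (hf : MemLp f 2 unif) :
    ‖hf.toLp f‖ = √(∫ u, f u ^ 2 ∂unif) := by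
  rw [← Real.sqrt_sq (norm_nonneg _), ← real_inner_self_eq_norm_sq, inner_toLp]
  simp_rw [sq]

theorem integral_mul_le_sqrt_mul_l2Norm {γ f : ℝ → ℝ} (hγ : MemLp γ 2 unif) (hf : MemLp f 2 unif)
    {r : ℝ} (hr : ∫ u, f u ^ 2 ∂unif ≤ r) : ∫ u, γ u * f u ∂unif ≤ √r * l2Norm γ := by
  rw [← inner_toLp hγ hf, mul_comm]
  refine (real_inner_le_norm _ _).trans ?_
  rw [norm_toLp_eq_sqrt, norm_toLp_eq_sqrt]
  exact mul_le_mul_of_nonneg_left (Real.sqrt_le_sqrt hr) (Real.sqrt_nonneg _)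

theorem l2Norm_sq (γ : ℝ → ℝ) : l2Norm γ ^ 2 = ∫ u, γ u ^ 2 ∂unif :=
  Real.sq_sqrt (integral_nonneg fun _ => sq_nonneg _)

theorem integral_pos_of_l2Norm_pos {γ : ℝ → ℝ} (hγ : MemLp γ 2 unif) (hpos : 0 < l2Norm γ)
    (h0 : ∀ u ∈ Ioo (0 : ℝ) 1, 0 ≤ γ u) : 0 < ∫ u, γ u ∂unif := by
  have hae : 0 ≤ᵐ[unif] γ := (ae_restrict_mem measurableSet_Ioo).mono h0
  refine (integral_nonneg_of_ae hae).lt_of_ne fun h => hpos.ne ?_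
  have hz := (integral_eq_zero_iff_of_nonneg_ae hae (hγ.integrable one_le_two)).1 h.symm
  rw [l2Norm, integral_congr_ae (g := fun _ => 0) (hz.mono fun u hu => by simp [hu]), integral_zero,
    Real.sqrt_zero]

theorem self_mem_bwBall {Ω : Type*} [MeasurableSpace Ω] {P : Measure Ω} {n : ℕ} (d : Fin n → ℝ)
    (ε : ℝ) {X : Ω → EuclideanSpace ℝ (Fin n)}
    (hX : AEMeasurable X P) : X ∈ bwBall (quadForm (Matrix.diagonal d)) P ε X := by
  refine ⟨hX, ?_⟩
  have hdiag : Measurable fun x : EuclideanSpace ℝ (Fin n) => (x, x) := by fun_prop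
  have hπ : (P.map X).map (fun x => (x, x)) ∈ couplings (P.map X) (P.map X) := by
    constructor
    · rw [Measure.map_map measurable_fst hdiag]; exact Measure.map_id
    · rw [Measure.map_map measurable_snd hdiag]; exact Measure.map_id
  refine (iInf₂_le _ hπ).trans ?_
  have hmeas : Measurable fun z : EuclideanSpace ℝ (Fin n) × EuclideanSpace ℝ (Fin n) =>
      ENNReal.ofReal (bregmanDiv (quadForm (Matrix.diagonal d)) z.1 z.2) := by
    simp_rw [bregmanDiv_quadForm_diagonal]
    fun_prop
  rw [lintegral_map hmeas hdiag]
  simp [bregmanDiv]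

section Bounds

variable {Ω : Type*} [MeasurableSpace Ω] {P : Measure Ω} [IsProbabilityMeasure P]

theorem memLp_qf {Y : Ω → ℝ} (hY : MemLp Y 2 P) : MemLp (qf (P.map Y)) 2 unif := by
  have hYm := hY.1.aemeasurable
  have := Measure.isProbabilityMeasure_map hYm
  have h1 : MemLp id 2 (P.map Y) := (memLp_map_measure_iff (by fun_prop) hYm).2 hY
  rw [← map_qf (P.map Y)] at h1
  exact (memLp_map_measure_iff (by fun_prop) (aemeasurable_qf _)).1 h1

/-- The signed Choquet integrals over the uncertainty set are quantile integrals, with an upper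
bound in terms of the Lipschitz constant. -/
theorem choquet_of_mem_bwBall {h γ : ℝ → ℝ} (h0 : h 0 = 0) (hγ : HasDistortionWeight h γ)
    (hγ2 : MemLp γ 2 unif) {n : ℕ} {g : EuclideanSpace ℝ (Fin n) → ℝ} {K : ℝ≥0}
    (hg : LipschitzWith K g) {d : Fin n → ℝ} {qmin : ℝ} (hqmin : 0 < qmin) (hd : ∀ i, qmin ≤ d i)
    {ε : ℝ} (hε : 0 < ε) {X Y : Ω → EuclideanSpace ℝ (Fin n)} (hX : AEMeasurable X P)
    (hint : Integrable (fun u => γ u * qf (P.map fun ω => g (X ω)) u) unif)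
    (hY : Y ∈ bwBall (quadForm (Matrix.diagonal d)) P ε X) :
    ChoquetFinite h P (fun ω => g (Y ω)) ∧
      signedChoquet h P (fun ω => g (Y ω)) = ∫ u, γ u * qf (P.map fun ω => g (Y ω)) u ∂unif ∧
      signedChoquet h P (fun ω => g (Y ω)) ≤
        signedChoquet h P (fun ω => g (X ω)) + √((K : ℝ) ^ 2 * ε / qmin) * l2Norm γ ∧
      MemLp (fun u => qf (P.map fun ω => g (Y ω)) u - qf (P.map fun ω => g (X ω)) u) 2 unif ∧
      ∫ u, (qf (P.map fun ω => g (Y ω)) u - qf (P.map fun ω => g (X ω)) u) ^ 2 ∂unif ≤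
        (K : ℝ) ^ 2 * ε / qmin := by
  have hgm : Measurable g := hg.continuous.measurable
  set q := qf (P.map fun ω => g (X ω)) with hq
  set qY := qf (P.map fun ω => g (Y ω)) with hqY
  have hγi : Integrable γ unif := hγ2.integrable one_le_two
  obtain ⟨hL, hr⟩ := memLp_two_of_lintegral_le ((aemeasurable_qf _).sub (aemeasurable_qf _))
    (by positivity) (lintegral_qf_sub_sq_le_of_mem_bwBall hg hqmin hd hX hY)
  -- Integrability passes from `X` to `Y` through the difference, the only part known to be in `L²`.
  have hdiff : Integrable (fun u => γ u * (qY u - q u)) unif := hγ2.integrable_mul hL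
  have hintY : Integrable (fun u => γ u * qY u) unif :=
    (hint.add hdiff).congr (ae_of_all _ fun u => by simp only [Pi.add_apply]; ring)
  obtain ⟨hXf, hXe⟩ := hγ.choquet_eq h0 hγi (hgm.comp_aemeasurable hX) hint
  obtain ⟨hYf, hYe⟩ := hγ.choquet_eq h0 hγi (hgm.comp_aemeasurable hY.1) hintY
  refine ⟨hYf, hYe, ?_, hL, hr⟩
  have hsum : ∫ u, γ u * qY u ∂unif = ∫ u, γ u * q u ∂unif + ∫ u, γ u * (qY u - q u) ∂unif := by
    rw [← integral_add hint hdiff]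
    exact integral_congr_ae (ae_of_all _ fun u => by ring)
  refine (hYe.trans hsum).trans_le ?_
  refine add_le_add hXe.ge (integral_mul_le_sqrt_mul_l2Norm hγ2 hL hr)

theorem exists_unique_isMultiplier {Y : Ω → ℝ} (hY : MemLp Y 2 P) {γ : ℝ → ℝ}
    (hγ : MemLp γ 2 unif) (hpos : 0 < ∫ u, γ u ∂unif) {c r : ℝ} (hc : 0 < c) (hr : 0 < r) :
    ∃ lam, ∀ t, IsMultiplier P Y γ c r t ↔ t = lam := by
  obtain ⟨s, hs, huniq⟩ := exists_unique_isotonic_radius (qf_mem_isotonicCone (memLp_qf hY)) hγ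
    hpos hr
  -- The substitution `s = 1 / (2 c lam)` is an involution of the positive reals, so uniqueness
  -- carries over.
  refine ⟨1 / (2 * c * s), fun t => ?_⟩
  have h1 := huniq (1 / (2 * c * t))
  have h2 : 0 < 1 / (2 * c * t) ↔ 0 < t := by
    rw [one_div, inv_pos, mul_pos_iff_of_pos_left (by positivity)]
  rw [h2] at h1
  refine h1.trans ⟨fun h => ?_, fun h => ?_⟩
  · have ht : t ≠ 0 := fun ht => hs.ne (by rw [← h, ht]; simp)
    rw [← h]; field_simp
  · rw [h]; field_simp

end Bounds

end

/-! ### Assembly of the bounds -/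

theorem mainTheorem12 {Ω : Type*} [MeasurableSpace Ω] (P : Measure Ω) [IsProbabilityMeasure P]
    (hP : NonAtomicMeasure P)
    -- the signed Choquet integral and its distortion weight function
    (h γ : ℝ → ℝ) (hh : IsDistortion h) (hγ : HasDistortionWeight h γ)
    (hγ_fin : MemLp γ 2 (volume.restrict (Ioo (0 : ℝ) 1))) (hγ_pos : 0 < l2Norm γ)
    -- the aggregation function
    {m k : ℕ} (g : EuclideanSpace ℝ (Fin (m + k)) → ℝ) (K : ℝ≥0) (hg : LipschitzWith K g)
    (gt : EuclideanSpace ℝ (Fin m) → ℝ) (β : EuclideanSpace ℝ (Fin k))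
    (hdec : HasLinearPart g gt β)
    -- the reference random vector
    (p : ℝ≥0∞) (hp : 1 ≤ p) (X : Ω → EuclideanSpace ℝ (Fin (m + k)))
    (hX : MemLp X p P) (hgX : MemLp (fun ω => g (X ω)) p P)
    (hfin : ChoquetFinite h P (fun ω => g (X ω)))
    -- the Mahalanobis matrix
    (Q : Matrix (Fin (m + k)) (Fin (m + k)) ℝ) (hQd : Q.IsDiag) (hQ : Q.PosDef)
    (qmin qmax : ℝ) (hqmin : IsLeast (spectrum ℝ Q) qmin) (hqmax : IsGreatest (spectrum ℝ Q) qmax)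
    (ε : ℝ) (hε : 0 < ε) :
    -- part (i): non-decreasing weight
    (MonotoneOn γ (Ioo 0 1) →
      (∀ Y ∈ bwBall (quadForm Q) P ε X, ChoquetFinite h P (fun ω => g (Y ω))) ∧
      ∃ s : ℝ,
        IsLUB ((fun Y => signedChoquet h P (fun ω => g (Y ω))) '' bwBall (quadForm Q) P ε X) s ∧
        signedChoquet h P (fun ω => g (X ω)) + √(‖β‖ ^ 2 * ε / qmax) * l2Norm γ ≤ s ∧
        s ≤ signedChoquet h P (fun ω => g (X ω)) + √((K : ℝ) ^ 2 * ε / qmin) * l2Norm γ) ∧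
    -- part (ii): non-negative weight
    ((∀ u ∈ Ioo (0 : ℝ) 1, 0 ≤ γ u) → MemLp (fun ω => g (X ω)) 2 P →
      (∀ Y ∈ bwBall (quadForm Q) P ε X, ChoquetFinite h P (fun ω => g (Y ω))) ∧
      ∃ s : ℝ,
        IsLUB ((fun Y => signedChoquet h P (fun ω => g (Y ω))) '' bwBall (quadForm Q) P ε X) s ∧
        (β ≠ 0 →
          ∃ lam : ℝ,
            (∀ t, IsMultiplier P (fun ω => g (X ω)) γ qmax (‖β‖ ^ 2 * ε / qmax) t ↔ t = lam) ∧
            ∫ u in Ioo (0 : ℝ) 1, γ u * projQuantile P (fun ω => g (X ω)) γ qmax lam u ≤ s) ∧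
        (0 < K →
          ∃ lam : ℝ,
            (∀ t, IsMultiplier P (fun ω => g (X ω)) γ qmin ((K : ℝ) ^ 2 * ε / qmin) t ↔ t = lam) ∧
            s ≤ ∫ u in Ioo (0 : ℝ) 1, γ u * projQuantile P (fun ω => g (X ω)) γ qmin lam u)) := by
  obtain ⟨d, rfl⟩ : ∃ d, Q = Matrix.diagonal d := ⟨Q.diag, hQd.diagonal_diag.symm⟩
  rw [spectrum_diagonal] at hqmin hqmax
  have hdpos : ∀ i, 0 < d i := Matrix.posDef_diagonal_iff.1 hQ
  have hd_min : ∀ i, qmin ≤ d i := fun i => hqmin.2 ⟨i, rfl⟩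
  have hd_max : ∀ i, d i ≤ qmax := fun i => hqmax.2 ⟨i, rfl⟩
  have hqmin0 : 0 < qmin := by
    obtain ⟨i, hi⟩ := hqmin.1
    exact hi ▸ hdpos i
  have hqmax0 : 0 < qmax := by
    obtain ⟨i, hi⟩ := hqmax.1
    exact hi ▸ hdpos i
  have hγi : Integrable γ unif := hγ_fin.integrable one_le_two
  have hXm : AEMeasurable X P := hX.1.aemeasurable
  have hgm : Measurable g := hg.continuous.measurable
  have hgXm : AEMeasurable (fun ω => g (X ω)) P := hgm.comp_aemeasurable hXm
  set q := qf (P.map fun ω => g (X ω)) with hq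
  set B := bwBall (quadForm (Matrix.diagonal d)) P ε X with hB
  set I : (Ω → EuclideanSpace ℝ (Fin (m + k))) → ℝ :=
    fun Y => signedChoquet h P (fun ω => g (Y ω)) with hI
  have hXB : X ∈ B := self_mem_bwBall d ε hXm
  have hball := fun (hint : Integrable (fun u => γ u * q u) unif) Y (hY : Y ∈ B) =>
    choquet_of_mem_bwBall hh.zero hγ hγ_fin hg hqmin0 hd_min hε hXm hint hY
  have hlub : Integrable (fun u => γ u * q u) unif → IsLUB (I '' B) (sSup (I '' B)) := fun hint =>
    isLUB_csSup ⟨_, X, hXB, rfl⟩ ⟨I X + √((K : ℝ) ^ 2 * ε / qmin) * l2Norm γ, by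
      rintro _ ⟨Y, hY, rfl⟩
      exact (hball hint Y hY).2.2.1⟩
  have hlow : Integrable (fun u => γ u * q u) unif → β ≠ 0 → ∀ G : ℝ → ℝ, MonotoneOn G (Ioo 0 1) →
      MemLp (fun u => G u - q u) 2 unif → ∫ u, (G u - q u) ^ 2 ∂unif ≤ ‖β‖ ^ 2 * ε / qmax →
      ∫ u, γ u * G u ∂unif ≤ sSup (I '' B) := fun hint hβ G hG hGL hGε => by
    obtain ⟨Y, hY, hYG⟩ :=
      exists_mem_bwBall_qf_eq hP hgm hdec hβ hqmax0 hd_max hXm hG hGL hGε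
    refine le_trans (le_of_eq ?_) ((hlub hint).1 ⟨Y, hY, rfl⟩)
    refine Eq.trans ?_ (hball hint Y hY).2.1.symm
    exact integral_congr_ae (hYG.mono fun u hu => by simp only [hu])
  refine ⟨fun hmono => ?_, fun hnonneg hgX2 => ?_⟩
  · have hint : Integrable (fun u => γ u * q u) unif :=
      hγ.integrable_mul_qf hh.zero hγi hmono hgXm hfin
    refine ⟨fun Y hY => (hball hint Y hY).1, sSup (I '' B), hlub hint, ?_, ?_⟩
    -- For `β = 0` the lower bound is the value at `X` itself.
    · by_cases hβ : β = 0
      · rw [hβ, norm_zero, zero_pow two_ne_zero, zero_mul, zero_div, Real.sqrt_zero, zero_mul,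
          add_zero]
        exact (hlub hint).1 ⟨X, hXB, rfl⟩
      -- This `c` puts `q + cγ` on the boundary of the inner ball, in the direction where
      -- Cauchy-Schwarz is an equality.
      · set c := √(‖β‖ ^ 2 * ε / qmax) / l2Norm γ with hc
        have hsq : ∀ u, q u + c * γ u - q u = c * γ u := fun u => by ring
        have hc2 : c ^ 2 * l2Norm γ ^ 2 = ‖β‖ ^ 2 * ε / qmax := by
          rw [← mul_pow, hc, div_mul_cancel₀ _ hγ_pos.ne', Real.sq_sqrt (by positivity)]
        have hle := hlow hint hβ (fun u => q u + c * γ u)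
          ((qf_monotoneOn _).add fun u hu v hv huv =>
            mul_le_mul_of_nonneg_left (hmono hu hv huv) (div_nonneg (Real.sqrt_nonneg _) hγ_pos.le))
          (by simp only [hsq]; exact hγ_fin.const_mul c)
          (by simp only [hsq, mul_pow]; rw [integral_const_mul, ← l2Norm_sq, hc2])
        refine le_trans (le_of_eq ?_) hle
        have hexp : ∀ u, γ u * (q u + c * γ u) = γ u * q u + c * γ u ^ 2 := fun u => by ring
        simp only [hexp]
        rw [integral_add hint (hγ_fin.integrable_sq.const_mul c), integral_const_mul, ← l2Norm_sq,
          (hball hint X hXB).2.1, sq (l2Norm γ), ← mul_assoc, hc, div_mul_cancel₀ _ hγ_pos.ne']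
    · refine (hlub hint).2 ?_
      rintro _ ⟨Y, hY, rfl⟩
      exact (hball hint Y hY).2.2.1
  · have hq2 : MemLp q 2 unif := memLp_qf hgX2
    have hint : Integrable (fun u => γ u * q u) unif := hγ_fin.integrable_mul hq2
    have hγ1 : 0 < ∫ u, γ u ∂unif := integral_pos_of_l2Norm_pos hγ_fin hγ_pos hnonneg
    refine ⟨fun Y hY => (hball hint Y hY).1, sSup (I '' B), hlub hint, fun hβ => ?_, fun hK => ?_⟩
    · obtain ⟨lam, hlam⟩ := exists_unique_isMultiplier (r := ‖β‖ ^ 2 * ε / qmax) hgX2 hγ_fin hγ1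
        hqmax0 (by positivity)
      refine ⟨lam, hlam, ?_⟩
      have hG : projQuantile P (fun ω => g (X ω)) γ qmax lam ∈ isotonicCone :=
        (isIsotonicProj_isotonicProj (memLp_perturb hq2 hγ_fin _)).1
      -- The multiplier equation places the projection exactly on the boundary of the inner ball, so
      -- it is attainable.
      refine hlow hint hβ _ hG.1 (hG.2.2.sub hq2) (le_of_eq ?_)
      rw [← ((hlam lam).2 rfl).2]
      exact integral_congr_ae (ae_of_all _ fun u => sub_sq_comm _ _)
    · have hK' : (0 : ℝ) < K := hK
      obtain ⟨lam, hlam⟩ := exists_unique_isMultiplier (r := (K : ℝ) ^ 2 * ε / qmin) hgX2 hγ_fin hγ1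
        hqmin0 (by positivity)
      refine ⟨lam, hlam, (hlub hint).2 ?_⟩
      rintro _ ⟨Y, hY, rfl⟩
      obtain ⟨-, hYe, -, hYL, hYr⟩ := hball hint Y hY
      obtain ⟨hlam0, hlamr⟩ := (hlam lam).2 rfl
      -- The quantile function of `g(Y)` lies in the cone and in the outer ball, whose radius is
      -- that of the projection.
      refine hYe.trans_le (integral_mul_le_isotonicProj hq2 hγ_fin
        (s := 1 / (2 * qmin * lam)) (by positivity) (qf_mem_isotonicCone ?_) ?_)
      · exact (hYL.add hq2).ae_eq (ae_of_all _ fun u => by simp [hq])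
      · exact hYr.trans_eq hlamr.symm
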